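/- **Lemma 6.3 (Finite Obstacles Lemma).** Let $\delta,K_1,K_2,C_0,C_1$ be positive integers and put $C=\min(C_0,C_1)$, $C'=\max(C_0,C_1)$. Assume that they are *acceptable*: $\delta\ge 3$, $1\le K_1\le K_2\le\delta$, $2\delta+2\le C_0,C_1\le 3\delta+2$, $C_0$ is even and $C_1$ is odd; and *(primitive) admissible*, i.e. one of the following holds: * (II) $C\le 2\delta+K_1$, $C=2K_1+2K_2+1$, $K_1+K_2\ge\delta$, $K_1+2K_2\le 2\delta-1$, and either $C'=C+1$, or $C'>C+1$, $K_1=K_2$ and $3K_2=2\delta-1$; * (III) $C\ge 2\delta+K_1+1$, $K_1+2K_2\ge 2\delta-1$, $3K_2\ge 2\delta$; if $K_1+2K_2=2\delta-1$ then $C\ge 2\delta+K_1+2$; and if $C'>C+1$ then $C\ge 2\delta+K_2$. Let $\mathcal A=\mathcal A^\delta_{K_1,K_2,C_0,C_1}$ be the class of all finite metric spaces $(M,d)$ with distances in $\{0,1,\dots,\delta\}$ such that for all distinct $u,v,w\in M$, with $p=d(u,v)+d(u,w)+d(v,w)$ and $m=\min\{d(u,v),d(u,w),d(v,w)\}$: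 if $p$ is odd then $2K_1<p$, $p<2K_2+2m$ and $p<C_1$; if $p$ is even then $p<C_0$. A *$\delta$-edge-labelled graph* is a loopless undirected graph with a label from $\{1,\dots,\delta\}$ on each edge, and a *homomorphism* is a map of vertices that sends every edge to an edge with the same label. A metric space with distances in $\{0,\dots,\delta\}$ is viewed as the complete graph whose edges are labelled by the distances. A *homomorphism-embedding* is a homomorphism whose restriction to every complete induced subgraph is an embedding. A graph $\mathbf G$ *has a completion in $\mathcal A$* if there is an injective homomorphism-embedding of $\mathbf G$ into some member of $\mathcal A$. Then there is a finite set $\mathcal O$ of $\delta$-edge-labelled cycles, each with at least $3$ and at most $2^\delta\cdot 3$ vertices, such that a finite $\delta$-edge-labelled graph $\mathbf G$ has a completion in $\mathcal A$ if and only if there is no $\mathbf O\in\mathcal O$ with a homomorphism $\mathbf O\to\mathbf G$. -/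

import Mathlib

universe u

/-- A `δ`-edge-labelled graph on the vertex set `V`, seen as a relational structure: `rel i u v`
says that `uv` is an edge of label `i`.  The labels are in `{1, …, δ}`, the relations are symmetric,
there are no loops, and every pair of vertices is in at most one of the relations. -/
structure EdgeLabelledGraph (δ : ℕ) (V : Type*) where
  rel : ℕ → V → V → Prop
  label_mem : ∀ {i : ℕ} {u v : V}, rel i u v → 1 ≤ i ∧ i ≤ δ
  symm : ∀ {i : ℕ} {u v : V}, rel i u v → rel i v u
  irrefl : ∀ (i : ℕ) (u : V), ¬ rel i u u
  label_unique : ∀ {i j : ℕ} {u v : V}, rel i u v → rel j u v → i = j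

namespace EdgeLabelledGraph

variable {δ : ℕ} {V W : Type*}

/-- The underlying graph, obtained by forgetting the labels. -/
def toSimpleGraph (G : EdgeLabelledGraph δ V) : SimpleGraph V where
  Adj u v := ∃ i, G.rel i u v
  symm := ⟨fun _ _ ⟨i, h⟩ => ⟨i, G.symm h⟩⟩
  loopless := ⟨fun u ⟨i, h⟩ => G.irrefl i u h⟩

/-- The (induced) substructure on a set of vertices. -/
def induce (G : EdgeLabelledGraph δ V) (s : Set V) : EdgeLabelledGraph δ s where
  rel i u v := G.rel i u v
  label_mem h := G.label_mem h
  symm h := G.symm h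
  irrefl i u := G.irrefl i u
  label_unique h h' := G.label_unique h h'

/-- A structure is irreducible if every two distinct vertices are in some relation. -/
def IsIrreducible (G : EdgeLabelledGraph δ V) : Prop :=
  ∀ u v : V, u ≠ v → ∃ i, G.rel i u v

/-- `f` is a homomorphism. -/
def IsHom (G : EdgeLabelledGraph δ V) (H : EdgeLabelledGraph δ W) (f : V → W) : Prop :=
  ∀ (i : ℕ) (u v : V), G.rel i u v → H.rel i (f u) (f v)

/-- `f` is an embedding: injective, and preserving and reflecting all the relations. -/
def IsEmb (G : EdgeLabelledGraph δ V) (H : EdgeLabelledGraph δ W) (f : V → W) : Prop :=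
  Function.Injective f ∧ ∀ (i : ℕ) (u v : V), G.rel i u v ↔ H.rel i (f u) (f v)

/-- `f` is a homomorphism-embedding: a homomorphism whose restriction to every irreducible
substructure is an embedding. -/
def IsHomEmb (G : EdgeLabelledGraph δ V) (H : EdgeLabelledGraph δ W) (f : V → W) : Prop :=
  IsHom G H f ∧
    ∀ s : Set V, (G.induce s).IsIrreducible → IsEmb (G.induce s) H (fun x : s => f x)

/-- `H` is a (strong) completion of `G`: it is irreducible and there is an injective
homomorphism-embedding of `G` into `H`. -/
def IsCompletionOf (H : EdgeLabelledGraph δ W) (G : EdgeLabelledGraph δ V) : Prop :=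
  H.IsIrreducible ∧ ∃ f : V → W, Function.Injective f ∧ IsHomEmb G H f

/-- `G` is an edge-labelled cycle: its underlying graph is a cycle (on at least three vertices). -/
def IsCycle (G : EdgeLabelledGraph δ V) : Prop :=
  ∃ n : ℕ, 3 ≤ n ∧ Nonempty (G.toSimpleGraph ≃g SimpleGraph.cycleGraph n)

end EdgeLabelledGraph

/-- A `δ`-valued metric space on `V`: a metric with values in `{0, 1, …, δ}`. -/
structure ValuedMetric (δ : ℕ) (V : Type*) where
  d : V → V → ℕ
  le_delta : ∀ u v : V, d u v ≤ δ
  eq_zero_iff : ∀ u v : V, d u v = 0 ↔ u = v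
  symm : ∀ u v : V, d u v = d v u
  triangle : ∀ u v w : V, d u w ≤ d u v + d v w

namespace ValuedMetric

variable {δ : ℕ} {V : Type*}

/-- A `δ`-valued metric space seen as a (complete) `δ`-edge-labelled graph. -/
def toEdgeLabelledGraph (M : ValuedMetric δ V) : EdgeLabelledGraph δ V where
  rel i u v := u ≠ v ∧ M.d u v = i
  label_mem := by
    rintro i u v ⟨h, rfl⟩
    exact ⟨Nat.one_le_iff_ne_zero.mpr (fun h0 => h ((M.eq_zero_iff u v).mp h0)), M.le_delta u v⟩
  symm := by
    rintro i u v ⟨h, h'⟩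
    exact ⟨h.symm, (M.symm v u).trans h'⟩
  irrefl _ _ h := h.1 rfl
  label_unique h h' := h.2.symm.trans h'.2

/-- The triangle constraints defining the class `𝒜^δ_{K₁, K₂, C₀, C₁}`: for every three distinct
points, with `p` the perimeter and `m` the length of the shortest edge, the `K₁`-, `K₂`-, `C₁`- and
`C₀`-bounds hold. -/
def InClassA (M : ValuedMetric δ V) (K₁ K₂ C₀ C₁ : ℕ) : Prop :=
  ∀ u v w : V, u ≠ v → v ≠ w → u ≠ w →
    let p := M.d u v + M.d u w + M.d v w
    let m := min (M.d u v) (min (M.d u w) (M.d v w))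
    (Odd p → 2 * K₁ < p) ∧
    (Odd p → p < 2 * K₂ + 2 * m) ∧
    (Odd p → p < C₁) ∧
    (Even p → p < C₀)

end ValuedMetric

/-- `G` has a completion in the class `𝒜^δ_{K₁, K₂, C₀, C₁}` of finite `δ`-valued metric spaces. -/
def EdgeLabelledGraph.HasCompletionInA {δ : ℕ} {V : Type u} (G : EdgeLabelledGraph δ V)
    (K₁ K₂ C₀ C₁ : ℕ) : Prop :=
  ∃ (W : Type u) (_ : Finite W) (M : ValuedMetric δ W),
    M.InClassA K₁ K₂ C₀ C₁ ∧ M.toEdgeLabelledGraph.IsCompletionOf G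

/-- Acceptable sequences of parameters. -/
structure AcceptableParameters (δ K₁ K₂ C₀ C₁ : ℕ) : Prop where
  three_le : 3 ≤ δ
  one_le_K₁ : 1 ≤ K₁
  K₁_le_K₂ : K₁ ≤ K₂
  K₂_le : K₂ ≤ δ
  le_C₀ : 2 * δ + 2 ≤ C₀
  C₀_le : C₀ ≤ 3 * δ + 2
  le_C₁ : 2 * δ + 2 ≤ C₁
  C₁_le : C₁ ≤ 3 * δ + 2
  even_C₀ : Even C₀
  odd_C₁ : Odd C₁

/-- Case (II), for `C = min C₀ C₁` and `C' = max C₀ C₁`. -/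
def AdmissibleCaseII (δ K₁ K₂ C C' : ℕ) : Prop :=
  C ≤ 2 * δ + K₁ ∧
  C = 2 * K₁ + 2 * K₂ + 1 ∧
  δ ≤ K₁ + K₂ ∧
  K₁ + 2 * K₂ ≤ 2 * δ - 1 ∧
  (C' = C + 1 ∨ (C + 1 < C' ∧ K₁ = K₂ ∧ 3 * K₂ = 2 * δ - 1))

/-- Case (III), for `C = min C₀ C₁` and `C' = max C₀ C₁`. -/
def AdmissibleCaseIII (δ K₁ K₂ C C' : ℕ) : Prop :=
  2 * δ + K₁ + 1 ≤ C ∧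
  2 * δ - 1 ≤ K₁ + 2 * K₂ ∧
  2 * δ ≤ 3 * K₂ ∧
  (K₁ + 2 * K₂ = 2 * δ - 1 → 2 * δ + K₁ + 2 ≤ C) ∧
  (C + 1 < C' → 2 * δ + K₂ ≤ C)

/-- Primitive admissible sequences of parameters: acceptable (which, through `3 ≤ δ`, a finite `K₁`
and `2δ + 2 ≤ C₀, C₁`, leaves only the primitive case) and in Case (II) or in Case (III). -/
def PrimitiveAdmissible (δ K₁ K₂ C₀ C₁ : ℕ) : Prop :=
  AcceptableParameters δ K₁ K₂ C₀ C₁ ∧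
    (AdmissibleCaseII δ K₁ K₂ (min C₀ C₁) (max C₀ C₁) ∨
      AdmissibleCaseIII δ K₁ K₂ (min C₀ C₁) (max C₀ C₁))

/-!
Completions are found by completing forks. Fix a distance `M` with `K₁, δ/2 ≤ M ≤ K₂` and
`2M + δ + 1 ≤ min C₀ C₁`, avoiding two borderline cases (`IsMagic`). Two edges `a`, `b` with a
common end force a distance on the third side: it is at most `a + b`, at least `|a - b|` and, when
all perimeters are less than `C`, at most `C - 1 - a - b`. Such a bound is used when it keeps the
distance away from `M`, and it is then iterated; `Forces x w` says that the labels of the word `w`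
force the distance `x` in this way. The order in which distances are forced (`forkTime`) bounds the
length of `w` by `2 ^ δ` (`Forces.length_le`).

Forced distances are sound (`Forces.bounds`): along a walk with labels `w` in a member of the class,
the actual distance of the end points is at least as far from `M` as `x`, on the same side. It also
has the parity of `x` when `x` is less than `K₁` or more than `K₂`, since otherwise an odd triangle
would violate the `K₁`- or the `K₂`-bound. A triangle with coinciding vertices satisfies all
constraints, so this holds for walks that repeat vertices, and hence for homomorphic images.

Conversely, give each pair of vertices of a graph its forced distance farthest from `M`, and `M` if
nothing is forced. (In Case (II) with `C' > C + 1`, two sides `δ` leave only even distances for the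
third side but no one-sided bound, while `M` is odd; such pairs get `M - 1` if nothing is forced.)
A triangle of these distances that violates a constraint either contains a fork that would have been
completed differently, or consists of three forced distances whose bounds and parities carry the
violation over to the actual distances. The arithmetic is in `IsMagic.allowedTriple_of_respects` and
`IsMagic.allowedTriple_of_respects_special`. The words of three forced distances form a closed walk
of length at most `3 * 2 ^ δ`, which a violation keeps from being realized in the class. So a graph whose
short closed walks are all realized has a completion (`Realizable.hasCompletionInA`).

The obstacles are the cycles with at most `3 * 2 ^ δ` vertices without a completion. If no obstacle
maps to `G`, then the short closed walks of `G` are realized in completions of cycles. If `G` has a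
completion, then so does every cycle that maps to `G`: its closed walks are realized in that of `G`.
-/

/-! ### Allowed triples and forced distances -/

/-- A triple of distances that may occur between three points, not necessarily distinct, of a
member of `𝒜^δ_{K₁, K₂, C₀, C₁}`. -/
def AllowedTriple (δ K₁ K₂ C₀ C₁ a b c : ℕ) : Prop :=
  a ≤ δ ∧ b ≤ δ ∧ c ≤ δ ∧ a ≤ b + c ∧ b ≤ a + c ∧ c ≤ a + b ∧
    ((a + b + c) % 2 = 1 → 2 * K₁ < a + b + c ∧ b + c < 2 * K₂ + a ∧ a + c < 2 * K₂ + b ∧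
      a + b < 2 * K₂ + c ∧ a + b + c < C₁) ∧
    ((a + b + c) % 2 = 0 → a + b + c < C₀)

/-- Admissible parameters together with a distance `M` that can serve as the default distance
between two points. Here `C` and `C'` are the smaller and the larger one of `C₀` and `C₁`. The
bounds on `M` say that, together with two sides `M`, every third side is allowed; the last two
conditions avoid borderline coincidences of `M` with `K₁` and `K₂`. -/
structure IsMagic (δ K₁ K₂ C₀ C₁ C C' M : ℕ) : Prop where
  acceptable : AcceptableParameters δ K₁ K₂ C₀ C₁
  eq_or_eq : C = C₀ ∧ C' = C₁ ∨ C = C₁ ∧ C' = C₀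
  lt : C < C'
  admissible : AdmissibleCaseII δ K₁ K₂ C C' ∨ AdmissibleCaseIII δ K₁ K₂ C C'
  K₁_le : K₁ ≤ M
  delta_le : δ ≤ 2 * M
  le_K₂ : M ≤ K₂
  le_C : 2 * M + δ + 1 ≤ C
  K₁_lt : 2 * δ + K₁ + 1 ≤ C → K₁ + 2 * K₂ = 2 * δ - 1 → K₁ < M
  lt_K₂ : 2 * δ + K₁ + 1 ≤ C → C + 1 < C' → C = 2 * δ + K₂ → M < K₂

/-- What a forced distance `x` says about the actual distance `a` in a member of the class: `a` is
at least as far from `M` as `x`, on the same side, and it has the parity of `x` when `x` is small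
or large enough for the `K₁`- and `K₂`-bounds to be of use. -/
def Bounds (δ K₁ K₂ C M x a : ℕ) : Prop :=
  (x < M → a ≤ x ∧ (x < K₁ ∨ x = K₁ ∧ 2 * δ + K₁ + 2 ≤ C → a % 2 = x % 2)) ∧
  (M < x → x ≤ a ∧ (K₂ < x ∨ x = K₂ ∧ 2 * δ + K₁ + 1 ≤ C → a % 2 = x % 2))

section Arithmetic

variable {δ K₁ K₂ C₀ C₁ C C' M : ℕ}

theorem PrimitiveAdmissible.exists_isMagic (h : PrimitiveAdmissible δ K₁ K₂ C₀ C₁) :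
    ∃ C C' M, IsMagic δ K₁ K₂ C₀ C₁ C C' M := by
  obtain ⟨ha, hc⟩ := h
  obtain ⟨h1, h2, h3, h4, h5, h6, h7, h8, ⟨e0, he0⟩, ⟨e1, he1⟩⟩ := id ha
  have hmin : min C₀ C₁ = C₀ ∧ max C₀ C₁ = C₁ ∨ min C₀ C₁ = C₁ ∧ max C₀ C₁ = C₀ := by omega
  have hlt : min C₀ C₁ < max C₀ C₁ := by omega
  have hle : 2 * δ + 2 ≤ min C₀ C₁ := by omega
  clear h5 h6 h7 h8 he0 he1
  generalize min C₀ C₁ = C at *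
  generalize max C₀ C₁ = C' at *
  refine ⟨C, C', ?_⟩
  suffices ∃ M, K₁ ≤ M ∧ δ ≤ 2 * M ∧ M ≤ K₂ ∧ 2 * M + δ + 1 ≤ C ∧
      (2 * δ + K₁ + 1 ≤ C → K₁ + 2 * K₂ = 2 * δ - 1 → K₁ < M) ∧
      (2 * δ + K₁ + 1 ≤ C → C + 1 < C' → C = 2 * δ + K₂ → M < K₂) by
    obtain ⟨M, m1, m2, m3, m4, m5, m6⟩ := this
    exact ⟨M, ha, hmin, hlt, hc, m1, m2, m3, m4, m5, m6⟩
  clear hmin ha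
  by_cases hb : 2 * δ + K₁ + 1 ≤ C ∧ K₁ + 2 * K₂ = 2 * δ - 1
  · rcases hc with ⟨c1, c2, c3, c4, c5⟩ | ⟨c1, c2, c3, c4, c5⟩
    · omega
    · rcases Nat.le_total (K₁ + 1) ((δ + 1) / 2) with h | h
      · refine ⟨(δ + 1) / 2, ?_, ?_, ?_, ?_, ?_, ?_⟩ <;> omega
      · refine ⟨K₁ + 1, ?_, ?_, ?_, ?_, ?_, ?_⟩ <;> omega
  · rcases hc with ⟨c1, c2, c3, c4, c5⟩ | ⟨c1, c2, c3, c4, c5⟩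
    all_goals
      rcases Nat.le_total K₁ ((δ + 1) / 2) with h | h
      · refine ⟨(δ + 1) / 2, ?_, ?_, ?_, ?_, ?_, ?_⟩ <;> omega
      · refine ⟨K₁, ?_, ?_, ?_, ?_, ?_, ?_⟩ <;> omega

theorem AllowedTriple.swap₁₂ {a b c : ℕ} (h : AllowedTriple δ K₁ K₂ C₀ C₁ a b c) :
    AllowedTriple δ K₁ K₂ C₀ C₁ b a c := by
  obtain ⟨t1, t2, t3, t4, t5, t6, t7, t8⟩ := h
  rw [Nat.add_comm a b] at t6 t7 t8
  exact ⟨t2, t1, t3, t5, t4, t6, fun h => by have := t7 h; omega, t8⟩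

theorem AllowedTriple.swap₂₃ {a b c : ℕ} (h : AllowedTriple δ K₁ K₂ C₀ C₁ a b c) :
    AllowedTriple δ K₁ K₂ C₀ C₁ a c b := by
  obtain ⟨t1, t2, t3, t4, t5, t6, t7, t8⟩ := h
  rw [Nat.add_right_comm a b c] at t7 t8
  exact ⟨t1, t3, t2, by omega, t6, t5, fun h => by have := t7 h; omega, t8⟩

theorem bounds_self (x : ℕ) : Bounds δ K₁ K₂ C M x x :=
  ⟨fun _ => ⟨le_rfl, fun _ => rfl⟩, fun _ => ⟨le_rfl, fun _ => rfl⟩⟩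

theorem Bounds.add {x y a b c : ℕ} (hx : Bounds δ K₁ K₂ C M x a)
    (hy : Bounds δ K₁ K₂ C M y b) (hx1 : 1 ≤ x) (hy1 : 1 ≤ y)
    (ht : AllowedTriple δ K₁ K₂ C₀ C₁ a b c) (hxy : x + y < M) :
    Bounds δ K₁ K₂ C M (x + y) c := by
  obtain ⟨hx2, -⟩ := hx
  obtain ⟨hy2, -⟩ := hy
  obtain ⟨hx3, hx4⟩ := hx2 (by omega)
  obtain ⟨hy3, hy4⟩ := hy2 (by omega)
  obtain ⟨-, -, -, t1, t2, t3, t4, -⟩ := ht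
  refine ⟨fun _ => ⟨by omega, fun h => ?_⟩, fun _ => by omega⟩
  have := hx4 (.inl (by omega))
  have := hy4 (.inl (by omega))
  by_contra hne
  have := (t4 (by omega)).1
  omega

/-- If `x` is large enough for the parity clause of `Bounds`, then `y ≤ δ - x` is small enough for
it. -/
theorem IsMagic.small_of_add_le (hM : IsMagic δ K₁ K₂ C₀ C₁ C C' M) {x y : ℕ} (hxd : x + y ≤ δ)
    (hx : K₂ < x ∨ x = K₂ ∧ 2 * δ + K₁ + 1 ≤ C) (hy : 1 ≤ y) :
    y < K₁ ∨ y = K₁ ∧ 2 * δ + K₁ + 2 ≤ C := by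
  obtain ⟨⟨h1, h2, h3, -⟩, -, -, hc, -⟩ := hM
  rcases hc with ⟨-, c2, c3, c4, -⟩ | ⟨c1, c2, c3, c4, -⟩ <;> omega

theorem Bounds.sub (hM : IsMagic δ K₁ K₂ C₀ C₁ C C' M)
    {x y a b c : ℕ} (hx : Bounds δ K₁ K₂ C M (x + y) a)
    (hy : Bounds δ K₁ K₂ C M y b) (hy1 : 1 ≤ y) (hxd : x + y ≤ δ)
    (ht : AllowedTriple δ K₁ K₂ C₀ C₁ a b c) (hxy : M < x) :
    Bounds δ K₁ K₂ C M x c := by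
  have m2 := hM.delta_le
  obtain ⟨hx3, hx4⟩ := hx.2 (by omega)
  obtain ⟨hy3, hy4⟩ := hy.1 (by omega)
  obtain ⟨-, -, -, t1, t2, t3, t4, -⟩ := ht
  refine ⟨fun _ => by omega, fun _ => ⟨by omega, fun h => ?_⟩⟩
  have ha := hx4 (.inl (by omega))
  have hb := hy4 (hM.small_of_add_le hxd h hy1)
  clear hx4 hy4 hxd
  by_contra hne
  have hodd : (a + b + c) % 2 = 1 := by
    clear t4 h t1 t2 t3
    omega
  have := (t4 hodd).2.2.1
  clear t4 ha hb hne hodd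
  omega

theorem AllowedTriple.perimeter_lt (hM : IsMagic δ K₁ K₂ C₀ C₁ C C' M) (hC : C' = C + 1)
    {a b c : ℕ} (ht : AllowedTriple δ K₁ K₂ C₀ C₁ a b c) : a + b + c < C := by
  obtain ⟨⟨-, -, -, -, -, -, -, -, ⟨e0, he0⟩, ⟨e1, he1⟩⟩, hCC, -⟩ := hM
  obtain ⟨-, -, -, -, -, -, t4, t5⟩ := ht
  rcases Nat.mod_two_eq_zero_or_one (a + b + c) with h | h
  · have := t5 h
    omega
  · have := (t4 h).2.2.2.2
    omega

theorem Bounds.perimeter (hM : IsMagic δ K₁ K₂ C₀ C₁ C C' M) (hC : C' = C + 1)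
    {x y z a b c : ℕ} (hx : Bounds δ K₁ K₂ C M x a)
    (hy : Bounds δ K₁ K₂ C M y b) (hxd : x ≤ δ) (hyd : y ≤ δ)
    (ht : AllowedTriple δ K₁ K₂ C₀ C₁ a b c) (hz : x + y + z + 1 = C) (hzM : z < M) :
    Bounds δ K₁ K₂ C M z c := by
  have m2 := hM.delta_le
  have m4 := hM.le_C
  obtain ⟨hx3, hx4⟩ := hx.2 (by omega)
  obtain ⟨hy3, hy4⟩ := hy.2 (by omega)
  have hper := ht.perimeter_lt hM hC
  have t4 := ht.2.2.2.2.2.2.1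
  refine ⟨fun _ => ⟨by omega, fun h => ?_⟩, fun _ => by omega⟩
  rcases hM.admissible with ⟨c1, c2, c3, c4, -⟩ | ⟨c1, c2, -, -, -⟩
  · have hzK : z < K₁ := by omega
    clear h
    have ha := hx4 (.inl (by omega))
    have hb := hy4 (.inl (by omega))
    clear hx4 hy4
    by_contra hne
    have := (t4 (by omega)).2.2.2.1
    omega
  · clear hx4 hy4 t4
    omega

end Arithmetic

/-! ### Triangles of completed distances -/

/-- The distance `z` respects what the distances `x` and `y` on the other two sides of a triangle
force by the triangle inequality and by the perimeter bound. -/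
structure Respects (C C' M x y z : ℕ) : Prop where
  add : x + y < M → z ≤ x + y
  sub_left : y + M < x → x ≤ y + z
  sub_right : x + M < y → y ≤ x + z
  perimeter : C' = C + 1 → C ≤ x + y + M → x + y + z < C

/-- The actual distance `a` between two points whose completed distance is `x ≠ M`, in Case (II)
with `C' > C + 1`: parity is always known, and the bound from above or below holds except for
`x = M - 1`, which is also the completed distance of pairs that only have to avoid `M`. -/
def ParityBounds (M x a : ℕ) : Prop :=
  a % 2 = x % 2 ∧ (M < x → x ≤ a) ∧ (x < M → a ≤ x ∨ x + 1 = M)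

section SortedTriple

variable {δ K₁ K₂ C₀ C₁ C C' M : ℕ}

section Generic

variable {x y z : ℕ}

theorem IsMagic.triangle_of_respects (hyz : z ≤ y)
    (hyzx : Respects C C' M y z x) (hxzy : Respects C C' M x z y)
    (hreal : x ≠ M → y ≠ M → z ≠ M → ∃ a b c, AllowedTriple δ K₁ K₂ C₀ C₁ a b c ∧
      Bounds δ K₁ K₂ C M x a ∧ Bounds δ K₁ K₂ C M y b ∧ Bounds δ K₁ K₂ C M z c) :
    x ≤ y + z := by
  by_contra hlt
  have h1 := hyzx.add
  have h2 := hxzy.sub_left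
  obtain ⟨a, b, c, ht, ha, hb, hc⟩ := hreal (by omega) (by omega) (by omega)
  have := (ha.2 (by omega)).1
  have := (hb.1 (by omega)).1
  have := (hc.1 (by omega)).1
  have := ht.2.2.2.1
  omega

theorem IsMagic.perimeter_lt_of_respects (hM : IsMagic δ K₁ K₂ C₀ C₁ C C' M) (hC : C' = C + 1)
    (hxy : y ≤ x) (hyz : z ≤ y) (hxyz : Respects C C' M x y z)
    (hreal : x ≠ M → y ≠ M → z ≠ M → ∃ a b c, AllowedTriple δ K₁ K₂ C₀ C₁ a b c ∧
      Bounds δ K₁ K₂ C M x a ∧ Bounds δ K₁ K₂ C M y b ∧ Bounds δ K₁ K₂ C M z c) :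
    x + y + z < C := by
  by_contra hlt
  have h1 := hxyz.perimeter hC
  obtain ⟨a, b, c, ht, ha, hb, hc⟩ := hreal (by omega) (by omega) (by omega)
  have := (ha.2 (by omega)).1
  have := (hb.2 (by omega)).1
  have := (hc.2 (by omega)).1
  have := ht.perimeter_lt hM hC
  omega

theorem IsMagic.two_mul_lt_of_odd (hM : IsMagic δ K₁ K₂ C₀ C₁ C C' M)
    (hxy : y ≤ x) (hyz : z ≤ y) (hx : x ≤ y + z) (hodd : (x + y + z) % 2 = 1)
    (hreal : x ≠ M → y ≠ M → z ≠ M → ∃ a b c, AllowedTriple δ K₁ K₂ C₀ C₁ a b c ∧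
      Bounds δ K₁ K₂ C M x a ∧ Bounds δ K₁ K₂ C M y b ∧ Bounds δ K₁ K₂ C M z c) :
    2 * K₁ < x + y + z := by
  by_contra hlt
  have hK := hM.K₁_le
  have hxK : x < K₁ := by omega
  obtain ⟨a, b, c, ht, ha, hb, hc⟩ := hreal (by omega) (by omega) (by omega)
  obtain ⟨ha, ha'⟩ := ha.1 (by omega)
  obtain ⟨hb, hb'⟩ := hb.1 (by omega)
  obtain ⟨hc, hc'⟩ := hc.1 (by omega)
  have ha' := ha' (.inl (by omega))
  have hb' := hb' (.inl (by omega))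
  have hc' := hc' (.inl (by omega))
  have hodd' : (a + b + c) % 2 = 1 := by clear ht hlt ha hb hc hK; omega
  have := (ht.2.2.2.2.2.2.1 hodd').1
  omega

/-- When two sides of an odd triangle violate the `K₂`-bound, the third side is below `M` and
short enough for the parity clause of `Bounds`. -/
theorem IsMagic.third_side_small (hM : IsMagic δ K₁ K₂ C₀ C₁ C C' M)
    (hns : C' = C + 1 ∨ 2 * δ + K₁ + 1 ≤ C) (hxd : x ≤ δ) (hyd : y ≤ δ)
    (hper : C' = C + 1 → x + y + z < C) (hlt : 2 * K₂ + z < x + y) :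
    z < M ∧ (z < K₁ ∨ z = K₁ ∧ 2 * δ + K₁ + 2 ≤ C) := by
  have m1 := hM.K₁_le
  have m5 := hM.K₁_lt
  have h1 := hM.acceptable.three_le
  rcases hM.admissible with ⟨c1, c2, c3, c4, -⟩ | ⟨c1, c2, -, c4, -⟩
  · have : z < K₁ := by
      rcases hns with h | h
      · have := hper h
        clear m5 hper
        omega
      · clear m5 hper
        omega
    exact ⟨by omega, .inl this⟩
  · have : z ≤ K₁ := by clear m5 hper hns c4; omega
    rcases this.lt_or_eq with h | h
    · exact ⟨by omega, .inl h⟩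
    · have heq : K₁ + 2 * K₂ = 2 * δ - 1 := by clear m5 hper hns c4; omega
      have := m5 c1 heq
      exact ⟨by omega, .inr ⟨h, c4 heq⟩⟩

theorem IsMagic.add_lt_of_odd (hM : IsMagic δ K₁ K₂ C₀ C₁ C C' M)
    (hns : C' = C + 1 ∨ 2 * δ + K₁ + 1 ≤ C) (hxd : x ≤ δ)
    (hxy : y ≤ x) (hx : x ≤ y + z) (hper : C' = C + 1 → x + y + z < C)
    (hodd : (x + y + z) % 2 = 1)
    (hreal : x ≠ M → y ≠ M → z ≠ M → ∃ a b c, AllowedTriple δ K₁ K₂ C₀ C₁ a b c ∧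
      Bounds δ K₁ K₂ C M x a ∧ Bounds δ K₁ K₂ C M y b ∧ Bounds δ K₁ K₂ C M z c) :
    x + y < 2 * K₂ + z := by
  by_contra hlt
  have hlt' : 2 * K₂ + z < x + y := by clear hper hns; omega
  obtain ⟨hzM, hzK⟩ := hM.third_side_small hns hxd (hxy.trans hxd) hper hlt'
  have hK := hM.le_K₂
  have hyK : K₂ < y := by clear hper hns hzK; omega
  obtain ⟨a, b, c, ht, ha, hb, hc⟩ := hreal (by omega) (by omega) (by omega)
  obtain ⟨ha, ha'⟩ := ha.2 (by omega)
  obtain ⟨hb, hb'⟩ := hb.2 (by omega)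
  obtain ⟨hc, hc'⟩ := hc.1 (by omega)
  have ha' := ha' (.inl (by omega))
  have hb' := hb' (.inl (by omega))
  have hc' := hc' hzK
  have hodd' : (a + b + c) % 2 = 1 := by clear ht hlt ha hb hc hK hzK hns hper; omega
  have := (ht.2.2.2.2.2.2.1 hodd').2.2.2.1
  clear hper hns hzK
  omega

theorem IsMagic.perimeter_bounds_of_caseIII (hM : IsMagic δ K₁ K₂ C₀ C₁ C C' M)
    (hIII : 2 * δ + K₁ + 1 ≤ C) (hCC : C + 1 < C') (hxd : x ≤ δ)
    (hxy : y ≤ x) (hyz : z ≤ y)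
    (hreal : x ≠ M → y ≠ M → z ≠ M → ∃ a b c, AllowedTriple δ K₁ K₂ C₀ C₁ a b c ∧
      Bounds δ K₁ K₂ C M x a ∧ Bounds δ K₁ K₂ C M y b ∧ Bounds δ K₁ K₂ C M z c) :
    ((x + y + z) % 2 = 1 → x + y + z < C₁) ∧ ((x + y + z) % 2 = 0 → x + y + z < C₀) := by
  have hle : C ≤ C₀ ∧ C ≤ C₁ := by
    have := hM.eq_or_eq
    omega
  by_cases hlt : x + y + z < C
  · exact ⟨fun _ => by omega, fun _ => by omega⟩
  have hCK : 2 * δ + K₂ ≤ C := by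
    rcases hM.admissible with h | h
    · have := h.1
      omega
    · exact h.2.2.2.2 hCC
  have hK := hM.le_K₂
  have hzK : K₂ ≤ z := by omega
  have hzM : M < z := by
    have := hM.lt_K₂ hIII hCC
    omega
  obtain ⟨a, b, c, ht, ha, hb, hc⟩ := hreal (by omega) (by omega) (by omega)
  obtain ⟨ha, ha'⟩ := ha.2 (by omega)
  obtain ⟨hb, hb'⟩ := hb.2 (by omega)
  obtain ⟨hc, hc'⟩ := hc.2 (by omega)
  have ha' := ha' (by omega)
  have hb' := hb' (by omega)
  have hc' := hc' (by omega)
  obtain ⟨-, -, -, -, -, -, t4, t5⟩ := ht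
  have hpar : (a + b + c) % 2 = (x + y + z) % 2 := by clear t4 t5 hlt; omega
  rw [hpar] at t4 t5
  refine ⟨fun h => ?_, fun h => ?_⟩
  · have := (t4 h).2.2.2.2
    omega
  · have := t5 h
    omega

theorem IsMagic.allowedTriple_of_respects (hM : IsMagic δ K₁ K₂ C₀ C₁ C C' M)
    (hns : C' = C + 1 ∨ 2 * δ + K₁ + 1 ≤ C) (hxd : x ≤ δ) (hxy : y ≤ x) (hyz : z ≤ y)
    (hxyz : Respects C C' M x y z) (hxzy : Respects C C' M x z y) (hyzx : Respects C C' M y z x)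
    (hreal : x ≠ M → y ≠ M → z ≠ M → ∃ a b c, AllowedTriple δ K₁ K₂ C₀ C₁ a b c ∧
      Bounds δ K₁ K₂ C M x a ∧ Bounds δ K₁ K₂ C M y b ∧ Bounds δ K₁ K₂ C M z c) :
    AllowedTriple δ K₁ K₂ C₀ C₁ x y z := by
  have hx := IsMagic.triangle_of_respects hyz hyzx hxzy hreal
  have hper := fun hC => hM.perimeter_lt_of_respects hC hxy hyz hxyz hreal
  have hbd : ((x + y + z) % 2 = 1 → x + y + z < C₁) ∧
      ((x + y + z) % 2 = 0 → x + y + z < C₀) := by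
    have hlt := hM.lt
    have heq := hM.eq_or_eq
    by_cases hC : C' = C + 1
    · have := hper hC
      exact ⟨fun _ => by omega, fun _ => by omega⟩
    · exact hM.perimeter_bounds_of_caseIII (hns.resolve_left hC) (by omega) hxd hxy hyz hreal
  refine ⟨hxd, by omega, by omega, hx, by omega, by omega, fun hodd => ?_, hbd.2⟩
  have h1 := hM.two_mul_lt_of_odd hxy hyz hx hodd hreal
  have h2 := hM.add_lt_of_odd hns hxd hxy hx hper hodd hreal
  exact ⟨h1, by omega, by omega, h2, hbd.1 hodd⟩

end Generic

section Special

variable {x y z : ℕ}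

/-- The parameters in Case (II) with `C' > C + 1` form a one-parameter family. -/
theorem IsMagic.special_eqs (hM : IsMagic δ K₁ K₂ C₀ C₁ C C' M) (hC : C + 1 < C')
    (hII : C < 2 * δ + K₁ + 1) :
    K₁ = M ∧ K₂ = M ∧ 3 * M + 1 = 2 * δ ∧ C₁ = 4 * M + 1 ∧ 4 * M + 4 ≤ C₀ ∧ 3 ≤ M ∧
      M % 2 = 1 := by
  obtain ⟨⟨h1, -, -, -, -, -, -, -, ⟨e0, he0⟩, ⟨e1, he1⟩⟩, hCC, -, hc, m1, m2, m3, -⟩ := hM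
  rcases hc with ⟨c1, c2, c3, c4, c5⟩ | ⟨c1, -⟩ <;> omega

theorem parity_of_parity {a b c x y z : ℕ} (ha : a % 2 = x % 2) (hb : b % 2 = y % 2)
    (hc : c % 2 = z % 2) : (a + b + c) % 2 = (x + y + z) % 2 :=
  Nat.ModEq.add (Nat.ModEq.add ha hb) hc

theorem special_triangle (hK₂ : K₂ = M) (h2 : M % 2 = 1) (hC₁ : C₁ = 4 * M + 1)
    (hyz : z ≤ y) (hyzx : Respects C C' M y z x) (hxzy : Respects C C' M x z y)
    (hreal : x ≠ M → y ≠ M → z ≠ M → ∃ a b c, AllowedTriple δ K₁ K₂ C₀ C₁ a b c ∧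
      ParityBounds M x a ∧ ParityBounds M y b ∧ ParityBounds M z c) :
    x ≤ y + z := by
  by_contra hlt
  have h1 := hyzx.add
  have h2' := hxzy.sub_left
  have hxz : x ≤ z + M := by omega
  have hMx : M < x := by omega
  have hyM : y < M := by omega
  clear h1 h2' hyzx hxzy
  obtain ⟨a, b, c, ht, ha, hb, hc⟩ := hreal (by omega) (by omega) (by omega)
  clear hreal
  have hax := ha.2.1 hMx
  have hby := hb.2.2 hyM
  have hcz := hc.2.2 (by omega)
  have hpar := parity_of_parity ha.1 hb.1 hc.1
  have hb2 := hb.1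
  have hc2 := hc.1
  clear ha hb hc
  obtain ⟨-, -, -, t1, -, -, t4, -⟩ := ht
  subst hK₂ hC₁
  -- If a side `M - 1` is not a bound for the actual distance, then `x` exceeds the other side by
  -- exactly `M`, so that the perimeter is odd and the `K₂`- and `C₁`-bounds apply.
  rcases hby with hby | hby
  · rcases hcz with hcz | hcz
    · clear t4 hpar hb2 hc2
      omega
    · have hyz : y = z := by omega
      have hx : x = z + K₂ := by omega
      have hodd : (x + y + z) % 2 = 1 := by clear t4 hpar hb2 hc2; omega
      have := t4 (hpar.trans hodd)
      clear t4 hpar hb2 hc2 hodd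
      omega
  · have hx : x = z + K₂ := by omega
    have hodd : (x + y + z) % 2 = 1 := by clear t4 hpar hb2 hc2 hcz; omega
    obtain ⟨s1, s2, s3, s4, s5⟩ := t4 (hpar.trans hodd)
    clear t4 hpar hodd
    rcases hcz with hcz | hcz
    · clear hb2 hc2
      omega
    · clear hyz
      omega

theorem special_two_mul_lt (hK₁ : K₁ = M) (hK₂ : K₂ = M) (h2 : M % 2 = 1) (h3 : 3 ≤ M)
    (hxy : y ≤ x) (hyz : z ≤ y) (hx : x ≤ y + z) (hodd : (x + y + z) % 2 = 1)
    (hreal : x ≠ M → y ≠ M → z ≠ M → ∃ a b c, AllowedTriple δ K₁ K₂ C₀ C₁ a b c ∧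
      ParityBounds M x a ∧ ParityBounds M y b ∧ ParityBounds M z c) :
    2 * K₁ < x + y + z := by
  by_contra hlt
  have hsum : x + y + z + 1 ≤ 2 * M := by omega
  have hxM : x < M := by clear hodd; omega
  obtain ⟨a, b, c, ht, ha, hb, hc⟩ := hreal (by omega) (by omega) (by omega)
  clear hreal
  have hax := ha.2.2 hxM
  have hby := hb.2.2 (by omega)
  have hcz := hc.2.2 (by omega)
  have ha2 := ha.1
  have hb2 := hb.1
  have hc2 := hc.1
  clear ha hb hc
  obtain ⟨-, -, -, t1, t2, t3, t4, -⟩ := ht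
  obtain ⟨s1, s2, s3, s4, -⟩ := t4 ((parity_of_parity ha2 hb2 hc2).trans hodd)
  clear t4 hlt
  subst hK₁ hK₂
  -- At most two sides can be the default `M - 1`; if there are two, then the third one is `1`,
  -- and the actual distances of the first two are equal and even, which leaves them no value.
  rcases hax with hax | hax
  · rcases hby with hby | hby
    · have hlt : a + b + c ≤ 2 * K₂ := by
        clear ha2 hb2 hc2 hodd
        rcases hcz with hcz | hcz
        · omega
        · omega
      omega
    · rcases hcz with hcz | hcz
      · clear ha2 hb2 hc2 hodd
        omega
      · omega
  · rcases hby with hby | hby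
    · rcases hcz with hcz | hcz
      · clear ha2 hb2 hc2 hodd
        omega
      · omega
    · have hz : z = 1 := by omega
      have hc1 : c = 1 := by
        rcases hcz with hcz | hcz
        · omega
        · omega
      have hab : a = b := by omega
      omega

theorem special_add_lt (hK₁ : K₁ = M) (hK₂ : K₂ = M) (h2 : M % 2 = 1)
    (hδ : 3 * M + 1 = 2 * δ) (hC₁ : C₁ = 4 * M + 1) (hxd : x ≤ δ)
    (hxy : y ≤ x) (hx : x ≤ y + z) (hodd : (x + y + z) % 2 = 1)
    (hstar : x = δ → y = δ → z ≠ M)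
    (hreal : x ≠ M → y ≠ M → z ≠ M → ∃ a b c, AllowedTriple δ K₁ K₂ C₀ C₁ a b c ∧
      ParityBounds M x a ∧ ParityBounds M y b ∧ ParityBounds M z c) :
    x + y < 2 * K₂ + z := by
  by_contra hlt
  have hlt' : 2 * M + z + 1 ≤ x + y := by clear hstar; omega
  have hyM : M < y := by clear hstar hodd; omega
  have hzM : z < M := by
    clear hodd
    by_contra
    exact hstar (by omega) (by omega) (by omega)
  obtain ⟨a, b, c, ht, ha, hb, hc⟩ := hreal (by omega) (by omega) (by omega)
  clear hreal hstar hlt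
  have hax := ha.2.1 (by omega)
  have hby := hb.2.1 hyM
  have hcz := hc.2.2 hzM
  have ha2 := ha.1
  have hb2 := hb.1
  have hc2 := hc.1
  clear ha hb hc
  obtain ⟨d1, d2, d3, t1, t2, t3, t4, -⟩ := ht
  obtain ⟨s1, s2, s3, s4, s5⟩ := t4 ((parity_of_parity ha2 hb2 hc2).trans hodd)
  clear t4
  subst hK₁ hK₂
  rcases hcz with hcz | hcz
  · clear ha2 hb2 hc2 hodd
    omega
  · -- Here `z = M - 1`, and `x + y` is odd, hence equal to `2 * δ - 1 = 3 * M`.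
    have hxy : x + y = 3 * K₂ := by clear ha2 hb2 hc2; omega
    have hc0 : c % 2 = 0 := by clear ha2 hb2 hodd; omega
    clear hodd hc2
    omega

theorem special_perimeter_bounds (hδ : 3 * M + 1 = 2 * δ) (hC₁ : C₁ = 4 * M + 1)
    (hC₀ : 4 * M + 4 ≤ C₀) (hxd : x ≤ δ) (hxy : y ≤ x) (hyz : z ≤ y)
    (hstar : x = δ → y = δ → z ≠ M)
    (hreal : x ≠ M → y ≠ M → z ≠ M → ∃ a b c, AllowedTriple δ K₁ K₂ C₀ C₁ a b c ∧
      ParityBounds M x a ∧ ParityBounds M y b ∧ ParityBounds M z c) :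
    ((x + y + z) % 2 = 1 → x + y + z < C₁) ∧ ((x + y + z) % 2 = 0 → x + y + z < C₀) := by
  by_cases hlt : x + y + z < C₁
  · exact ⟨fun _ => by omega, fun _ => by omega⟩
  have hzM : M < z := by
    by_contra
    exact hstar (by omega) (by omega) (by omega)
  obtain ⟨a, b, c, ht, ha, hb, hc⟩ := hreal (by omega) (by omega) (by omega)
  clear hreal hstar
  have hax := ha.2.1 (by omega)
  have hby := hb.2.1 (by omega)
  have hcz := hc.2.1 hzM
  have hpar := parity_of_parity ha.1 hb.1 hc.1
  clear ha hb hc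
  obtain ⟨-, -, -, -, -, -, t4, t5⟩ := ht
  rw [hpar] at t4 t5
  refine ⟨fun h => ?_, fun h => ?_⟩
  · have := (t4 h).2.2.2.2
    clear t4 t5 hpar
    omega
  · have := t5 h
    clear t4 t5 hpar
    omega

theorem IsMagic.allowedTriple_of_respects_special (hM : IsMagic δ K₁ K₂ C₀ C₁ C C' M)
    (hC : C + 1 < C') (hII : C < 2 * δ + K₁ + 1) (hxd : x ≤ δ)
    (hxy : y ≤ x) (hyz : z ≤ y) (hxzy : Respects C C' M x z y) (hyzx : Respects C C' M y z x)
    (hstar : x = δ → y = δ → z ≠ M)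
    (hreal : x ≠ M → y ≠ M → z ≠ M → ∃ a b c, AllowedTriple δ K₁ K₂ C₀ C₁ a b c ∧
      ParityBounds M x a ∧ ParityBounds M y b ∧ ParityBounds M z c) :
    AllowedTriple δ K₁ K₂ C₀ C₁ x y z := by
  obtain ⟨hK₁, hK₂, hδ, hC₁, hC₀, h3, h2⟩ := hM.special_eqs hC hII
  have hx := special_triangle hK₂ h2 hC₁ hyz hyzx hxzy hreal
  have hbd := special_perimeter_bounds hδ hC₁ hC₀ hxd hxy hyz hstar hreal
  refine ⟨hxd, by omega, by omega, hx, by omega, by omega, fun hodd => ?_, hbd.2⟩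
  have h4 := special_two_mul_lt hK₁ hK₂ h2 h3 hxy hyz hx hodd hreal
  have h5 := special_add_lt hK₁ hK₂ h2 hδ hC₁ hxd hxy hx hodd hstar hreal
  exact ⟨h4, by omega, by omega, h5, hbd.1 hodd⟩

end Special

end SortedTriple

/-! ### Walks and forced distances -/

namespace EdgeLabelledGraph

variable {δ : ℕ} {V W : Type*}

/-- `G.LabelWalk w u v`: some walk in `G` from `u` to `v` reads the word `w` of labels. -/
inductive LabelWalk (G : EdgeLabelledGraph δ V) : List ℕ → V → V → Prop
  | nil (u : V) : LabelWalk G [] u u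
  | cons {i : ℕ} {w : List ℕ} {u v x : V} (h : G.rel i u v) (hw : LabelWalk G w v x) :
      LabelWalk G (i :: w) u x

namespace LabelWalk

variable {G : EdgeLabelledGraph δ V} {H : EdgeLabelledGraph δ W} {w w₁ w₂ : List ℕ} {u v x : V}

theorem single {i : ℕ} (h : G.rel i u v) : G.LabelWalk [i] u v :=
  .cons h (.nil v)

theorem rel_of_single {i : ℕ} (h : G.LabelWalk [i] u v) : G.rel i u v := by
  cases h with
  | cons h hw =>
    cases hw
    exact h

theorem append (h₁ : G.LabelWalk w₁ u v) (h₂ : G.LabelWalk w₂ v x) :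
    G.LabelWalk (w₁ ++ w₂) u x := by
  induction h₁ with
  | nil => exact h₂
  | cons h _ ih => exact .cons h (ih h₂)

theorem exists_of_append (h : G.LabelWalk (w₁ ++ w₂) u x) :
    ∃ v, G.LabelWalk w₁ u v ∧ G.LabelWalk w₂ v x := by
  induction w₁ generalizing u with
  | nil => exact ⟨u, .nil u, h⟩
  | cons i w ih =>
    cases h with
    | cons h hw =>
      obtain ⟨v, h1, h2⟩ := ih hw
      exact ⟨v, .cons h h1, h2⟩

theorem reverse (h : G.LabelWalk w u v) : G.LabelWalk w.reverse v u := by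
  induction h with
  | nil u => exact .nil u
  | cons h _ ih =>
    rw [List.reverse_cons]
    exact ih.append (single (G.symm h))

theorem map {f : V → W} (hf : IsHom G H f) (h : G.LabelWalk w u v) :
    H.LabelWalk w (f u) (f v) := by
  induction h with
  | nil u => exact .nil _
  | cons h _ ih => exact .cons (hf _ _ _ h) ih

theorem exists_vertices (h : G.LabelWalk w u v) :
    ∃ p : ℕ → V, p 0 = u ∧ p w.length = v ∧
      ∀ k < w.length, G.rel (w.getD k 0) (p k) (p (k + 1)) := by
  induction h with
  | nil u => exact ⟨fun _ => u, rfl, rfl, fun k hk => absurd hk (Nat.not_lt_zero k)⟩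
  | @cons i w u v x h _ ih =>
    obtain ⟨p, h0, h1, hp⟩ := ih
    refine ⟨fun k => Nat.casesOn k u p, rfl, h1, fun k hk => ?_⟩
    cases k with
    | zero => simpa [h0] using h
    | succ k => simpa using hp k (by simpa using hk)

theorem of_vertices (p : ℕ → V) (hp : ∀ k < w.length, G.rel (w.getD k 0) (p k) (p (k + 1))) :
    G.LabelWalk w (p 0) (p w.length) := by
  induction w generalizing p with
  | nil => exact .nil _
  | cons i w ih =>
    refine .cons (by simpa using hp 0 (by simp)) (ih (fun k => p (k + 1)) fun k hk => ?_)
    simpa using hp (k + 1) (by simpa using hk)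

end LabelWalk

end EdgeLabelledGraph

/-- `Forces δ C C' M x w`: along any walk reading the word `w`, the distance `x ≠ M` is forced by
repeatedly completing forks, that is, paths with two edges, always to a distance on the far side
of `M`. A fork with sides `a` and `b` is completed to `a + b` if this is less than `M`, to the
difference of `a` and `b` if this is larger than `M`, and to `C - 1 - a - b` if this is less than
`M` (the last one only for `C' = C + 1`, when all perimeters are less than `C`). Single labels,
which may equal `M`, force themselves. -/
inductive Forces (δ C C' M : ℕ) : ℕ → List ℕ → Prop
  | single {x : ℕ} (h₁ : 1 ≤ x) (h₂ : x ≤ δ) : Forces δ C C' M x [x]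
  | add {x y : ℕ} {w₁ w₂ : List ℕ} (h₁ : Forces δ C C' M x w₁) (h₂ : Forces δ C C' M y w₂)
      (h : x + y < M) : Forces δ C C' M (x + y) (w₁ ++ w₂)
  | sub_left {x y : ℕ} {w₁ w₂ : List ℕ} (h₁ : Forces δ C C' M (x + y) w₁)
      (h₂ : Forces δ C C' M y w₂) (h : M < x) : Forces δ C C' M x (w₁ ++ w₂)
  | sub_right {x y : ℕ} {w₁ w₂ : List ℕ} (h₁ : Forces δ C C' M y w₁)
      (h₂ : Forces δ C C' M (x + y) w₂) (h : M < x) : Forces δ C C' M x (w₁ ++ w₂)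
  | perimeter {x y z : ℕ} {w₁ w₂ : List ℕ} (hC : C' = C + 1) (h₁ : Forces δ C C' M x w₁)
      (h₂ : Forces δ C C' M y w₂) (h : x + y + z + 1 = C) (hz : z < M) :
      Forces δ C C' M z (w₁ ++ w₂)

section Soundness

variable {δ K₁ K₂ C₀ C₁ C C' M : ℕ}

theorem IsMagic.two_mul_add_two_le (hM : IsMagic δ K₁ K₂ C₀ C₁ C C' M) : 2 * δ + 2 ≤ C := by
  have := hM.acceptable.le_C₀
  have := hM.acceptable.le_C₁
  have := hM.eq_or_eq
  omega

theorem Forces.mem_Icc (hM : IsMagic δ K₁ K₂ C₀ C₁ C C' M) {x : ℕ} {w : List ℕ}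
    (h : Forces δ C C' M x w) : 1 ≤ x ∧ x ≤ δ := by
  have h1 := hM.two_mul_add_two_le
  have h2 := hM.acceptable.K₂_le
  have h3 := hM.le_K₂
  induction h with
  | single h₁ h₂ => exact ⟨h₁, h₂⟩
  | add => omega
  | sub_left => omega
  | sub_right => omega
  | perimeter => omega

theorem Forces.reverse {x : ℕ} {w : List ℕ} (h : Forces δ C C' M x w) :
    Forces δ C C' M x w.reverse := by
  induction h with
  | single h₁ h₂ => exact .single h₁ h₂
  | add _ _ h ih₁ ih₂ =>
    rw [List.reverse_append, Nat.add_comm]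
    exact .add ih₂ ih₁ (by omega)
  | sub_left _ _ h ih₁ ih₂ =>
    rw [List.reverse_append]
    exact .sub_right ih₂ ih₁ h
  | sub_right _ _ h ih₁ ih₂ =>
    rw [List.reverse_append]
    exact .sub_left ih₂ ih₁ h
  | perimeter hC _ _ h hz ih₁ ih₂ =>
    rw [List.reverse_append]
    exact .perimeter hC ih₂ ih₁ (by omega) hz

/-- No fork is completed to the diameter. -/
theorem Forces.eq_single_of_eq_delta (hM : IsMagic δ K₁ K₂ C₀ C₁ C C' M) {x : ℕ} {w : List ℕ}
    (h : Forces δ C C' M x w) (hx : x = δ) : w = [δ] := by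
  have h2 := hM.acceptable.K₂_le
  have h3 := hM.le_K₂
  cases h with
  | single h₁ h₂ => rw [hx]
  | add => omega
  | sub_left h₁ h₂ =>
    have := h₁.mem_Icc hM
    have := h₂.mem_Icc hM
    omega
  | sub_right h₁ h₂ =>
    have := h₁.mem_Icc hM
    have := h₂.mem_Icc hM
    omega
  | perimeter => omega

theorem ValuedMetric.InClassA.allowedTriple {W : Type*} {N : ValuedMetric δ W}
    (hN : N.InClassA K₁ K₂ C₀ C₁) (h : AcceptableParameters δ K₁ K₂ C₀ C₁) (p q r : W) :
    AllowedTriple δ K₁ K₂ C₀ C₁ (N.d p q) (N.d q r) (N.d p r) := by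
  have l1 := N.le_delta p q
  have l2 := N.le_delta q r
  have l3 := N.le_delta p r
  have t1 := N.triangle p r q
  have t2 := N.triangle q p r
  have t3 := N.triangle p q r
  rw [N.symm r q] at t1
  rw [N.symm q p] at t2
  have hC := h.le_C₀
  refine ⟨l1, l2, l3, by omega, by omega, t3, ?_⟩
  by_cases hpq : p = q
  · have := (N.eq_zero_iff p q).2 hpq
    subst hpq
    constructor <;> intro <;> omega
  by_cases hqr : q = r
  · have := (N.eq_zero_iff q r).2 hqr
    subst hqr
    constructor <;> intro <;> omega
  by_cases hpr : p = r
  · have := (N.eq_zero_iff p r).2 hpr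
    subst hpr
    rw [N.symm q p] at *
    constructor <;> intro <;> omega
  obtain ⟨a1, a2, a3, a4⟩ := hN p q r hpq hqr hpr
  rw [Nat.add_right_comm] at a1 a2 a3 a4
  rw [Nat.odd_iff] at a1 a2 a3
  rw [Nat.even_iff] at a4
  refine ⟨fun hodd => ?_, a4⟩
  have a1 := a1 hodd
  have a2 := a2 hodd
  have a3 := a3 hodd
  clear a4 hodd
  refine ⟨a1, ?_, ?_, ?_, a3⟩ <;> omega

/-- Forced distances are correct: they bound the actual distances in every member of the class, for
walks of any kind, closed ones and ones with repeated vertices included. -/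
theorem Forces.bounds (hM : IsMagic δ K₁ K₂ C₀ C₁ C C' M) {W : Type*} {N : ValuedMetric δ W}
    (hN : N.InClassA K₁ K₂ C₀ C₁) {x : ℕ} {w : List ℕ} (h : Forces δ C C' M x w) {p r : W}
    (hw : N.toEdgeLabelledGraph.LabelWalk w p r) : Bounds δ K₁ K₂ C M x (N.d p r) := by
  induction h generalizing p r with
  | single =>
    rw [hw.rel_of_single.2]
    exact bounds_self _
  | add h₁ h₂ h ih₁ ih₂ =>
    obtain ⟨q, hw₁, hw₂⟩ := hw.exists_of_append
    exact (ih₁ hw₁).add (ih₂ hw₂) (h₁.mem_Icc hM).1 (h₂.mem_Icc hM).1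
      (hN.allowedTriple hM.acceptable p q r) h
  | sub_left h₁ h₂ h ih₁ ih₂ =>
    obtain ⟨q, hw₁, hw₂⟩ := hw.exists_of_append
    exact (ih₁ hw₁).sub hM (ih₂ hw₂) (h₂.mem_Icc hM).1 (h₁.mem_Icc hM).2
      (hN.allowedTriple hM.acceptable p q r) h
  | sub_right h₁ h₂ h ih₁ ih₂ =>
    obtain ⟨q, hw₁, hw₂⟩ := hw.exists_of_append
    exact (ih₂ hw₂).sub hM (ih₁ hw₁) (h₁.mem_Icc hM).1 (h₂.mem_Icc hM).2
      (hN.allowedTriple hM.acceptable p q r).swap₁₂ h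
  | perimeter hC h₁ h₂ h hz ih₁ ih₂ =>
    obtain ⟨q, hw₁, hw₂⟩ := hw.exists_of_append
    exact (ih₁ hw₁).perimeter hM hC (ih₂ hw₂) (h₁.mem_Icc hM).2 (h₂.mem_Icc hM).2
      (hN.allowedTriple hM.acceptable p q r) h hz

end Soundness

section Length

/-- The time at which forks are completed to the distance `x ≠ M`: far distances come first,
alternating between the two sides of `M`. -/
def forkTime (δ M x : ℕ) : ℕ := if x < M then 2 * x - 1 else 2 * (δ - x)

/-- The number of distances that are completed before `x`. -/
def forkRank (δ M x : ℕ) : ℕ :=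
  ((Finset.Icc 1 δ).filter fun y => forkTime δ M y < forkTime δ M x).card

variable {δ K₁ K₂ C₀ C₁ C C' M : ℕ}

theorem forkRank_le (x : ℕ) : forkRank δ M x ≤ δ :=
  (Finset.card_filter_le _ _).trans (by simp)

theorem forkRank_lt {x y : ℕ} (hy : 1 ≤ y ∧ y ≤ δ) (h : forkTime δ M y < forkTime δ M x) :
    forkRank δ M y < forkRank δ M x := by
  refine Finset.card_lt_card ⟨fun z hz => ?_, fun hsub => ?_⟩
  · rw [Finset.mem_filter] at hz ⊢
    exact ⟨hz.1, hz.2.trans h⟩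
  · have : y ∈ (Finset.Icc 1 δ).filter fun z => forkTime δ M z < forkTime δ M y :=
      hsub (Finset.mem_filter.2 ⟨Finset.mem_Icc.2 hy, h⟩)
    exact lt_irrefl _ (Finset.mem_filter.1 this).2

theorem length_append_le_two_pow {w₁ w₂ : List ℕ} {x y z : ℕ}
    (h₁ : w₁.length ≤ 2 ^ forkRank δ M x) (h₂ : w₂.length ≤ 2 ^ forkRank δ M y)
    (hx : 1 ≤ x ∧ x ≤ δ) (hy : 1 ≤ y ∧ y ≤ δ) (hxz : forkTime δ M x < forkTime δ M z)
    (hyz : forkTime δ M y < forkTime δ M z) :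
    (w₁ ++ w₂).length ≤ 2 ^ forkRank δ M z := by
  have hlt := max_lt (forkRank_lt hx hxz) (forkRank_lt hy hyz)
  have h3 := Nat.pow_le_pow_right (n := 2) (by norm_num)
    (le_max_left (forkRank δ M x) (forkRank δ M y))
  have h4 := Nat.pow_le_pow_right (n := 2) (by norm_num)
    (le_max_right (forkRank δ M x) (forkRank δ M y))
  have h5 := Nat.pow_le_pow_right (n := 2) (by norm_num) hlt
  rw [Nat.succ_eq_add_one, pow_succ] at h5
  rw [List.length_append]
  omega

theorem Forces.length_le_forkRank (hM : IsMagic δ K₁ K₂ C₀ C₁ C C' M) {x : ℕ} {w : List ℕ}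
    (h : Forces δ C C' M x w) : w.length ≤ 2 ^ forkRank δ M x := by
  have hδ := hM.delta_le
  have hC1 := hM.two_mul_add_two_le
  have hC2 := hM.le_C
  induction h with
  | single => exact Nat.one_le_two_pow
  | add h₁ h₂ h ih₁ ih₂ =>
    have hx := h₁.mem_Icc hM
    have hy := h₂.mem_Icc hM
    refine length_append_le_two_pow ih₁ ih₂ hx hy ?_ ?_ <;>
      · unfold forkTime
        rw [if_pos (by omega), if_pos (by omega)]
        omega
  | sub_left h₁ h₂ h ih₁ ih₂ =>
    have hx := h₁.mem_Icc hM
    have hy := h₂.mem_Icc hM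
    refine length_append_le_two_pow ih₁ ih₂ hx hy ?_ ?_
    · unfold forkTime
      rw [if_neg (by omega), if_neg (by omega)]
      omega
    · unfold forkTime
      rw [if_pos (by omega), if_neg (by omega)]
      omega
  | sub_right h₁ h₂ h ih₁ ih₂ =>
    have hx := h₂.mem_Icc hM
    have hy := h₁.mem_Icc hM
    refine length_append_le_two_pow ih₁ ih₂ hy hx ?_ ?_
    · unfold forkTime
      rw [if_pos (by omega), if_neg (by omega)]
      omega
    · unfold forkTime
      rw [if_neg (by omega), if_neg (by omega)]
      omega
  | perimeter hC h₁ h₂ h hz ih₁ ih₂ =>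
    have hx := h₁.mem_Icc hM
    have hy := h₂.mem_Icc hM
    refine length_append_le_two_pow ih₁ ih₂ hx hy ?_ ?_ <;>
      · unfold forkTime
        rw [if_neg (by omega), if_pos (by omega)]
        omega

theorem Forces.length_le (hM : IsMagic δ K₁ K₂ C₀ C₁ C C' M) {x : ℕ} {w : List ℕ}
    (h : Forces δ C C' M x w) : w.length ≤ 2 ^ δ :=
  (h.length_le_forkRank hM).trans (Nat.pow_le_pow_right (by norm_num) (forkRank_le x))

end Length

/-! ### The completion of a realizable graph -/

universe v

/-- `G` is realizable if every short closed walk of `G`, as a word of labels, is also read along a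
closed walk in some member of the class. -/
def EdgeLabelledGraph.Realizable {δ : ℕ} {V : Type*} (G : EdgeLabelledGraph δ V)
    (K₁ K₂ C₀ C₁ : ℕ) : Prop :=
  ∀ (w : List ℕ) (u : V), G.LabelWalk w u u → w.length ≤ 2 ^ δ * 3 →
    ∃ (W : Type v) (N : ValuedMetric δ W) (p : W), N.InClassA K₁ K₂ C₀ C₁ ∧
      N.toEdgeLabelledGraph.LabelWalk w p p

/-- The distance chosen for a pair of points when `F` is the set of distances forced between them
and `A` says that the pair is to avoid the distance `M` although nothing is forced. -/
noncomputable def chosenDist (M : ℕ) (F : ℕ → Prop) (A : Prop) : ℕ :=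
  open Classical in
  if ∃ x, F x ∧ x < M then sInf {x | F x ∧ x < M}
  else if ∃ x, F x ∧ M < x then sSup {x | F x ∧ M < x}
  else if A then M - 1 else M

section chosenDist

variable {M b y : ℕ} {F : ℕ → Prop} {A : Prop}

theorem chosenDist_mem (hF : ∀ x, F x → x ≤ b) (h : ∃ x, F x ∧ x ≠ M) :
    F (chosenDist M F A) ∧ chosenDist M F A ≠ M := by
  unfold chosenDist
  split_ifs with h1 h2
  · have := Nat.sInf_mem (s := {x | F x ∧ x < M}) h1
    exact ⟨this.1, this.2.ne⟩
  · have := Nat.sSup_mem (s := {x | F x ∧ M < x}) h2 ⟨b, fun x hx => hF x hx.1⟩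
    exact ⟨this.1, this.2.ne'⟩
  all_goals
    obtain ⟨x, hx, hne⟩ := h
    rcases hne.lt_or_gt with h | h
    · exact absurd ⟨x, hx, h⟩ h1
    · exact absurd ⟨x, hx, h⟩ h2

theorem chosenDist_le (hy : F y) (hyM : y < M) : chosenDist M F A ≤ y := by
  unfold chosenDist
  rw [if_pos ⟨y, hy, hyM⟩]
  exact Nat.sInf_le ⟨hy, hyM⟩

theorem le_chosenDist (hF : ∀ x, F x → x ≤ b) (hcons : ∀ x, F x → x < M → ∀ z, F z → ¬ M < z)
    (hy : F y) (hyM : M < y) : y ≤ chosenDist M F A := by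
  unfold chosenDist
  rw [if_neg fun ⟨x, hx, hxM⟩ => hcons x hx hxM y hy hyM, if_pos ⟨y, hy, hyM⟩]
  exact le_csSup ⟨b, fun x hx => hF x hx.1⟩ ⟨hy, hyM⟩

theorem chosenDist_cases (hF : ∀ x, F x → x ≤ b) (h : chosenDist M F A ≠ M) :
    F (chosenDist M F A) ∨
      (A ∧ chosenDist M F A = M - 1 ∧ ∀ x, F x → x = M) := by
  by_cases hex : ∃ x, F x ∧ x ≠ M
  · exact .inl (chosenDist_mem hF hex).1
  · right
    have h1 : ¬ ∃ x, F x ∧ x < M := fun ⟨x, hx, hxM⟩ => hex ⟨x, hx, hxM.ne⟩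
    have h2 : ¬ ∃ x, F x ∧ M < x := fun ⟨x, hx, hxM⟩ => hex ⟨x, hx, hxM.ne'⟩
    have h3 : A := by
      by_contra h3
      exact h (by unfold chosenDist; rw [if_neg h1, if_neg h2, if_neg h3])
    refine ⟨h3, by unfold chosenDist; rw [if_neg h1, if_neg h2, if_pos h3], fun x hx => ?_⟩
    by_contra hne
    exact hex ⟨x, hx, hne⟩

theorem chosenDist_ne (hF : ∀ x, F x → x ≤ b) (hM : 1 ≤ M) (hA : A) : chosenDist M F A ≠ M := by
  by_cases hex : ∃ x, F x ∧ x ≠ M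
  · exact (chosenDist_mem hF hex).2
  · unfold chosenDist
    rw [if_neg fun ⟨x, hx, hxM⟩ => hex ⟨x, hx, hxM.ne⟩,
      if_neg fun ⟨x, hx, hxM⟩ => hex ⟨x, hx, hxM.ne'⟩, if_pos hA]
    omega

end chosenDist

namespace EdgeLabelledGraph

variable {δ K₁ K₂ C₀ C₁ C C' M : ℕ} {V : Type*} {G : EdgeLabelledGraph δ V}

/-- The distance `x` is forced between `u` and `v` along some walk. -/
def Forced (G : EdgeLabelledGraph δ V) (C C' M x : ℕ) (u v : V) : Prop :=
  ∃ w, Forces δ C C' M x w ∧ G.LabelWalk w u v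

/-- The points `u` and `v` have a common neighbour at distance `δ`, in Case (II) with `C' > C + 1`.
This excludes the distance `M`, and all other odd distances, but it bounds the distance on neither
side, so that it is not a case of `Forced`. -/
def AvoidsMagic (G : EdgeLabelledGraph δ V) (K₁ C C' : ℕ) (u v : V) : Prop :=
  C + 1 < C' ∧ C < 2 * δ + K₁ + 1 ∧ ∃ w, G.rel δ u w ∧ G.rel δ w v

/-- The distance of two points in the completion of `G`. -/
noncomputable def completedDist (G : EdgeLabelledGraph δ V) (K₁ C C' M : ℕ) (u v : V) : ℕ :=
  open Classical in
  if u = v then 0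
  else chosenDist M (fun x => G.Forced C C' M x u v) (G.AvoidsMagic K₁ C C' u v)

theorem forced_comm {x : ℕ} {u v : V} : G.Forced C C' M x u v ↔ G.Forced C C' M x v u :=
  ⟨fun ⟨w, h, hw⟩ => ⟨w.reverse, h.reverse, hw.reverse⟩,
    fun ⟨w, h, hw⟩ => ⟨w.reverse, h.reverse, hw.reverse⟩⟩

theorem avoidsMagic_comm {u v : V} : G.AvoidsMagic K₁ C C' u v ↔ G.AvoidsMagic K₁ C C' v u :=
  ⟨fun ⟨h1, h2, w, h3, h4⟩ => ⟨h1, h2, w, G.symm h4, G.symm h3⟩,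
    fun ⟨h1, h2, w, h3, h4⟩ => ⟨h1, h2, w, G.symm h4, G.symm h3⟩⟩

theorem completedDist_of_ne {u v : V} (h : u ≠ v) : G.completedDist K₁ C C' M u v =
    chosenDist M (fun x => G.Forced C C' M x u v) (G.AvoidsMagic K₁ C C' u v) :=
  if_neg h

theorem completedDist_self (u : V) : G.completedDist K₁ C C' M u u = 0 :=
  if_pos rfl

theorem completedDist_comm (u v : V) :
    G.completedDist K₁ C C' M u v = G.completedDist K₁ C C' M v u := by
  by_cases h : u = v
  · rw [h]
  · rw [completedDist_of_ne h, completedDist_of_ne (Ne.symm h)]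
    congr 1
    · funext x
      exact propext forced_comm
    · exact propext avoidsMagic_comm

theorem Forced.le (hM : IsMagic δ K₁ K₂ C₀ C₁ C C' M) {u v : V} (x : ℕ)
    (h : G.Forced C C' M x u v) : x ≤ δ :=
  (h.choose_spec.1.mem_Icc hM).2

theorem Forced.of_rel {i : ℕ} {u v : V} (h : G.rel i u v) : G.Forced C C' M i u v :=
  ⟨[i], .single (G.label_mem h).1 (G.label_mem h).2, .single h⟩

theorem Forced.rel_delta (hM : IsMagic δ K₁ K₂ C₀ C₁ C C' M) {u v : V}
    (h : G.Forced C C' M δ u v) : G.rel δ u v := by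
  obtain ⟨w, hf, hw⟩ := h
  rw [hf.eq_single_of_eq_delta hM rfl] at hw
  exact hw.rel_of_single

theorem Realizable.exists_triple (hG : Realizable.{v} G K₁ K₂ C₀ C₁)
    {u v x : V} {w₁ w₂ w₃ : List ℕ} (h₁ : G.LabelWalk w₁ u v)
    (h₂ : G.LabelWalk w₂ v x) (h₃ : G.LabelWalk w₃ u x) (l₁ : w₁.length ≤ 2 ^ δ)
    (l₂ : w₂.length ≤ 2 ^ δ) (l₃ : w₃.length ≤ 2 ^ δ) :
    ∃ (W : Type v) (N : ValuedMetric δ W) (p q r : W), N.InClassA K₁ K₂ C₀ C₁ ∧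
      N.toEdgeLabelledGraph.LabelWalk w₁ p q ∧ N.toEdgeLabelledGraph.LabelWalk w₂ q r ∧
      N.toEdgeLabelledGraph.LabelWalk w₃ p r := by
  obtain ⟨W, N, p, hN, hw⟩ := hG (w₁ ++ (w₂ ++ w₃.reverse)) u (h₁.append (h₂.append h₃.reverse))
    (by simp only [List.length_append, List.length_reverse]; omega)
  obtain ⟨q, hq, hw⟩ := hw.exists_of_append
  obtain ⟨r, hr, hw⟩ := hw.exists_of_append
  refine ⟨W, N, p, q, r, hN, hq, hr, ?_⟩
  simpa using hw.reverse

theorem Realizable.exists_pair (hG : Realizable.{v} G K₁ K₂ C₀ C₁)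
    {u v : V} {w₁ w₂ : List ℕ} (h₁ : G.LabelWalk w₁ u v)
    (h₂ : G.LabelWalk w₂ u v) (l₁ : w₁.length ≤ 2 ^ δ) (l₂ : w₂.length ≤ 2 ^ δ) :
    ∃ (W : Type v) (N : ValuedMetric δ W) (p q : W), N.InClassA K₁ K₂ C₀ C₁ ∧
      N.toEdgeLabelledGraph.LabelWalk w₁ p q ∧ N.toEdgeLabelledGraph.LabelWalk w₂ p q := by
  obtain ⟨W, N, p, q, r, hN, h₁, h₂, h₃⟩ := hG.exists_triple h₁ (.nil v) h₂ l₁ (by simp) l₂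
  cases h₂
  exact ⟨W, N, p, q, hN, h₁, h₃⟩

theorem Realizable.not_lt_of_forced (hG : Realizable.{v} G K₁ K₂ C₀ C₁)
    (hM : IsMagic δ K₁ K₂ C₀ C₁ C C' M) {u v : V} (x : ℕ)
    (hx : G.Forced C C' M x u v) (hxM : x < M) (z : ℕ) (hz : G.Forced C C' M z u v) :
    ¬ M < z := by
  intro hzM
  obtain ⟨w₁, f₁, h₁⟩ := hx
  obtain ⟨w₂, f₂, h₂⟩ := hz
  obtain ⟨W, N, p, q, hN, h₁, h₂⟩ := hG.exists_pair h₁ h₂ (f₁.length_le hM) (f₂.length_le hM)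
  have b1 := ((f₁.bounds hM hN h₁).1 hxM).1
  have b2 := ((f₂.bounds hM hN h₂).2 hzM).1
  omega

theorem Realizable.le_completedDist (hG : Realizable.{v} G K₁ K₂ C₀ C₁)
    (hM : IsMagic δ K₁ K₂ C₀ C₁ C C' M) {u v : V} (huv : u ≠ v)
    {y : ℕ} (hy : G.Forced C C' M y u v) (hyM : M < y) : y ≤ G.completedDist K₁ C C' M u v := by
  rw [completedDist_of_ne huv]
  exact le_chosenDist (Forced.le hM) (hG.not_lt_of_forced hM) hy hyM

theorem completedDist_le {u v : V} (huv : u ≠ v)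
    {y : ℕ} (hy : G.Forced C C' M y u v) (hyM : y < M) : G.completedDist K₁ C C' M u v ≤ y := by
  rw [completedDist_of_ne huv]
  exact chosenDist_le hy hyM

theorem completedDist_cases (hM : IsMagic δ K₁ K₂ C₀ C₁ C C' M) {u v : V} (huv : u ≠ v)
    (h : G.completedDist K₁ C C' M u v ≠ M) :
    G.Forced C C' M (G.completedDist K₁ C C' M u v) u v ∨
      (G.AvoidsMagic K₁ C C' u v ∧ G.completedDist K₁ C C' M u v = M - 1 ∧
        ∀ x, G.Forced C C' M x u v → x = M) := by
  rw [completedDist_of_ne huv] at h ⊢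
  exact chosenDist_cases (Forced.le hM) h

theorem one_le_completedDist (hM : IsMagic δ K₁ K₂ C₀ C₁ C C' M) {u v : V} (huv : u ≠ v) :
    1 ≤ G.completedDist K₁ C C' M u v := by
  have h1 := hM.acceptable.one_le_K₁
  have h2 := hM.K₁_le
  by_cases h : G.completedDist K₁ C C' M u v = M
  · omega
  · rcases completedDist_cases hM huv h with ⟨w, hf, -⟩ | ⟨⟨h3, h4, -⟩, h5, -⟩
    · exact (hf.mem_Icc hM).1
    · have := (hM.special_eqs h3 h4).2.2.2.2.2.1
      omega

theorem completedDist_le_delta (hM : IsMagic δ K₁ K₂ C₀ C₁ C C' M) (u v : V) :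
    G.completedDist K₁ C C' M u v ≤ δ := by
  have h1 := hM.acceptable.K₂_le
  have h2 := hM.le_K₂
  by_cases huv : u = v
  · subst huv
    rw [completedDist_self]
    exact Nat.zero_le _
  by_cases h : G.completedDist K₁ C C' M u v = M
  · omega
  · rcases completedDist_cases hM huv h with hf | ⟨-, h5, -⟩
    · exact hf.le hM
    · omega

/-- A completed distance `x ≠ M` with `x + 1 ≠ M`, or with `C' = C + 1`, or in Case (III), is
forced. -/
theorem forced_completedDist (hM : IsMagic δ K₁ K₂ C₀ C₁ C C' M) {u v : V} (huv : u ≠ v)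
    (h : G.completedDist K₁ C C' M u v ≠ M)
    (h' : C + 1 < C' → C < 2 * δ + K₁ + 1 → G.completedDist K₁ C C' M u v + 1 ≠ M) :
    G.Forced C C' M (G.completedDist K₁ C C' M u v) u v := by
  rcases completedDist_cases hM huv h with hf | ⟨⟨h3, h4, -⟩, h5, -⟩
  · exact hf
  · have := hM.acceptable.one_le_K₁
    have := hM.K₁_le
    have := h' h3 h4
    omega

theorem Forced.append_add {x y : ℕ} {u v t : V} (hx : G.Forced C C' M x u v)
    (hy : G.Forced C C' M y v t) (h : x + y < M) : G.Forced C C' M (x + y) u t :=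
  let ⟨w₁, f₁, h₁⟩ := hx
  let ⟨w₂, f₂, h₂⟩ := hy
  ⟨w₁ ++ w₂, f₁.add f₂ h, h₁.append h₂⟩

theorem Forced.append_sub {x y : ℕ} {u v t : V} (hx : G.Forced C C' M (x + y) u v)
    (hy : G.Forced C C' M y v t) (h : M < x) : G.Forced C C' M x u t :=
  let ⟨w₁, f₁, h₁⟩ := hx
  let ⟨w₂, f₂, h₂⟩ := hy
  ⟨w₁ ++ w₂, f₁.sub_left f₂ h, h₁.append h₂⟩

theorem Forced.append_perimeter {x y z : ℕ} {u v t : V} (hC : C' = C + 1)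
    (hx : G.Forced C C' M x u v) (hy : G.Forced C C' M y v t) (h : x + y + z + 1 = C)
    (hz : z < M) : G.Forced C C' M z u t :=
  let ⟨w₁, f₁, h₁⟩ := hx
  let ⟨w₂, f₂, h₂⟩ := hy
  ⟨w₁ ++ w₂, f₁.perimeter hC f₂ h hz, h₁.append h₂⟩

theorem Realizable.le_add_completedDist (hG : Realizable.{v} G K₁ K₂ C₀ C₁)
    (hM : IsMagic δ K₁ K₂ C₀ C₁ C C' M) {u v t : V} (huv : u ≠ v) (hvt : v ≠ t) (hut : u ≠ t)
    (h : G.completedDist K₁ C C' M v t + M < G.completedDist K₁ C C' M u v) :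
    G.completedDist K₁ C C' M u v ≤
      G.completedDist K₁ C C' M v t + G.completedDist K₁ C C' M u t := by
  have l1 := completedDist_le_delta (G := G) hM u v
  have hδ := hM.delta_le
  have f1 : G.Forced C C' M (G.completedDist K₁ C C' M u v) u v :=
    forced_completedDist hM huv (by omega) (fun _ _ => by omega)
  have f2 : G.Forced C C' M (G.completedDist K₁ C C' M v t) v t := by
    refine forced_completedDist hM hvt ?_ (fun h3 h4 => ?_)
    · have := hM.acceptable.three_le
      omega
    · have := hM.special_eqs h3 h4
      omega
  have := hG.le_completedDist hM hut
    (Forced.append_sub (x := G.completedDist K₁ C C' M u v - G.completedDist K₁ C C' M v t)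
      (by rwa [Nat.sub_add_cancel (by omega)]) f2 (by omega)) (by omega)
  omega

theorem Realizable.respects (hG : Realizable.{v} G K₁ K₂ C₀ C₁)
    (hM : IsMagic δ K₁ K₂ C₀ C₁ C C' M) {u v t : V} (huv : u ≠ v) (hvt : v ≠ t) (hut : u ≠ t) :
    Respects C C' M (G.completedDist K₁ C C' M u v) (G.completedDist K₁ C C' M v t)
      (G.completedDist K₁ C C' M u t) where
  add h := by
    have h1 := one_le_completedDist (G := G) hM huv
    have h2 := one_le_completedDist (G := G) hM hvt
    exact completedDist_le hut
      ((forced_completedDist hM huv (by omega) (fun _ _ => by omega)).append_add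
        (forced_completedDist hM hvt (by omega) (fun _ _ => by omega)) h) h
  sub_left h := hG.le_add_completedDist hM huv hvt hut h
  sub_right h := by
    have := hG.le_add_completedDist hM hvt.symm huv.symm hut.symm
    rw [completedDist_comm t v, completedDist_comm v u, completedDist_comm t u] at this
    exact this h
  perimeter hC h := by
    have l1 := completedDist_le_delta (G := G) hM u v
    have l2 := completedDist_le_delta (G := G) hM v t
    have c1 := hM.le_C
    have c2 := hM.two_mul_add_two_le
    have f := (forced_completedDist (G := G) hM huv (by omega)
      (fun _ _ => by omega)).append_perimeter
        (z := C - 1 - (G.completedDist K₁ C C' M u v + G.completedDist K₁ C C' M v t)) hC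
        (forced_completedDist hM hvt (by omega) (fun _ _ => by omega)) (by omega)
        (by omega)
    have := completedDist_le (K₁ := K₁) hut f (by omega)
    omega

/-- Outside the special part of Case (II), a completed distance other than `M` is certified by a
short walk. -/
theorem exists_walk_bounds (hM : IsMagic δ K₁ K₂ C₀ C₁ C C' M)
    (hns : C' = C + 1 ∨ 2 * δ + K₁ + 1 ≤ C) {u v : V} (huv : u ≠ v)
    (h : G.completedDist K₁ C C' M u v ≠ M) :
    ∃ w, w.length ≤ 2 ^ δ ∧ G.LabelWalk w u v ∧
      ∀ (W : Type v) (N : ValuedMetric δ W) (p q : W), N.InClassA K₁ K₂ C₀ C₁ →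
        N.toEdgeLabelledGraph.LabelWalk w p q →
        Bounds δ K₁ K₂ C M (G.completedDist K₁ C C' M u v) (N.d p q) := by
  obtain ⟨w, hf, hw⟩ := forced_completedDist hM huv h (fun _ _ => by omega)
  exact ⟨w, hf.length_le hM, hw, fun _ _ _ _ hN hw => hf.bounds hM hN hw⟩

/-- Two sides of length `δ` leave only even distances for the third side, in Case (II) with
`C' > C + 1`. -/
theorem _root_.IsMagic.even_of_delta_delta (hM : IsMagic δ K₁ K₂ C₀ C₁ C C' M) (h3 : C + 1 < C')
    (h4 : C < 2 * δ + K₁ + 1) {a : ℕ} (ht : AllowedTriple δ K₁ K₂ C₀ C₁ δ δ a) : a % 2 = 0 := by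
  obtain ⟨e1, e2, e3, e4, -, -, -⟩ := hM.special_eqs h3 h4
  by_contra hne
  obtain ⟨s1, s2, s3, s4, s5⟩ := ht.2.2.2.2.2.2.1 (by clear ht; omega)
  clear ht hne
  omega

theorem exists_walk_parityBounds (hM : IsMagic δ K₁ K₂ C₀ C₁ C C' M) (h3 : C + 1 < C')
    (h4 : C < 2 * δ + K₁ + 1) {u v : V} (huv : u ≠ v) (h : G.completedDist K₁ C C' M u v ≠ M) :
    ∃ w, w.length ≤ 2 ^ δ ∧ G.LabelWalk w u v ∧
      ∀ (W : Type v) (N : ValuedMetric δ W) (p q : W), N.InClassA K₁ K₂ C₀ C₁ →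
        N.toEdgeLabelledGraph.LabelWalk w p q →
        ParityBounds M (G.completedDist K₁ C C' M u v) (N.d p q) := by
  obtain ⟨e1, e2, e3, e4, e5, e6, e7⟩ := hM.special_eqs h3 h4
  rcases completedDist_cases hM huv h with ⟨w, hf, hw⟩ | ⟨⟨-, -, t, ht1, ht2⟩, h5, -⟩
  · refine ⟨w, hf.length_le hM, hw, fun W N p q hN hw => ?_⟩
    obtain ⟨b1, b2⟩ := hf.bounds hM hN hw
    refine ⟨?_, fun hlt => (b2 hlt).1, fun hlt => .inl (b1 hlt).1⟩
    rcases Nat.lt_or_gt_of_ne h with h | h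
    · exact (b1 h).2 (.inl (e1.symm ▸ h))
    · exact (b2 h).2 (.inl (e2.symm ▸ h))
  · refine ⟨[δ] ++ [δ], ?_, (LabelWalk.single ht1).append (.single ht2),
      fun W N p q hN hw => ?_⟩
    · have := Nat.pow_le_pow_right (n := 2) (by norm_num) hM.acceptable.three_le
      simp only [List.length_append, List.length_singleton]
      omega
    · obtain ⟨r, hr1, hr2⟩ := hw.exists_of_append
      have hT := hN.allowedTriple hM.acceptable p r q
      rw [hr1.rel_of_single.2, hr2.rel_of_single.2] at hT
      have heven := hM.even_of_delta_delta h3 h4 hT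
      refine ⟨by omega, fun _ => by omega, fun _ => .inr (by omega)⟩

/-- The distances of three points in the completion form an allowed triple; here the sides are
sorted by length. -/
theorem Realizable.allowedTriple_of_sorted (hG : Realizable.{v} G K₁ K₂ C₀ C₁)
    (hM : IsMagic δ K₁ K₂ C₀ C₁ C C' M) {u v t : V} (huv : u ≠ v) (hvt : v ≠ t) (hut : u ≠ t)
    (h1 : G.completedDist K₁ C C' M v t ≤ G.completedDist K₁ C C' M u v)
    (h2 : G.completedDist K₁ C C' M u t ≤ G.completedDist K₁ C C' M v t) :
    AllowedTriple δ K₁ K₂ C₀ C₁ (G.completedDist K₁ C C' M u v)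
      (G.completedDist K₁ C C' M v t) (G.completedDist K₁ C C' M u t) := by
  have hxd := completedDist_le_delta (G := G) hM u v
  have r1 := hG.respects hM huv hvt hut
  have r2 := hG.respects hM huv.symm hut hvt
  have r3 := hG.respects hM hvt hut.symm huv.symm
  rw [completedDist_comm v u] at r2 r3
  rw [completedDist_comm t u] at r3
  by_cases hns : C' = C + 1 ∨ 2 * δ + K₁ + 1 ≤ C
  · refine hM.allowedTriple_of_respects hns hxd h1 h2 r1 r2 r3 fun n1 n2 n3 => ?_
    obtain ⟨w₁, l₁, hw₁, b₁⟩ := exists_walk_bounds hM hns huv n1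
    obtain ⟨w₂, l₂, hw₂, b₂⟩ := exists_walk_bounds hM hns hvt n2
    obtain ⟨w₃, l₃, hw₃, b₃⟩ := exists_walk_bounds hM hns hut n3
    obtain ⟨W, N, p, q, r, hN, hw₁, hw₂, hw₃⟩ := hG.exists_triple hw₁ hw₂ hw₃ l₁ l₂ l₃
    exact ⟨_, _, _, hN.allowedTriple hM.acceptable p q r, b₁ W N p q hN hw₁, b₂ W N q r hN hw₂,
      b₃ W N p r hN hw₃⟩
  · have hlt := hM.lt
    have h3 : C + 1 < C' := by omega
    have h4 : C < 2 * δ + K₁ + 1 := by omega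
    have e6 := (hM.special_eqs h3 h4).2.2.2.2.2.1
    refine hM.allowedTriple_of_respects_special h3 h4 hxd h1 h2 r2 r3
      (fun d1 d2 => ?_) fun n1 n2 n3 => ?_
    · have e3 := (hM.special_eqs h3 h4).2.2.1
      have f1 := forced_completedDist (G := G) hM huv (by omega) (fun _ _ => by omega)
      have f2 := forced_completedDist (G := G) hM hvt (by omega) (fun _ _ => by omega)
      rw [d1] at f1
      rw [d2] at f2
      rw [completedDist_of_ne hut]
      exact chosenDist_ne (Forced.le hM) (by omega)
        ⟨h3, h4, v, f1.rel_delta hM, f2.rel_delta hM⟩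
    · obtain ⟨w₁, l₁, hw₁, b₁⟩ := exists_walk_parityBounds hM h3 h4 huv n1
      obtain ⟨w₂, l₂, hw₂, b₂⟩ := exists_walk_parityBounds hM h3 h4 hvt n2
      obtain ⟨w₃, l₃, hw₃, b₃⟩ := exists_walk_parityBounds hM h3 h4 hut n3
      obtain ⟨W, N, p, q, r, hN, hw₁, hw₂, hw₃⟩ := hG.exists_triple hw₁ hw₂ hw₃ l₁ l₂ l₃
      exact ⟨_, _, _, hN.allowedTriple hM.acceptable p q r, b₁ W N p q hN hw₁,
        b₂ W N q r hN hw₂, b₃ W N p r hN hw₃⟩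

theorem Realizable.allowedTriple (hG : Realizable.{v} G K₁ K₂ C₀ C₁)
    (hM : IsMagic δ K₁ K₂ C₀ C₁ C C' M) {u v t : V} (huv : u ≠ v) (hvt : v ≠ t) (hut : u ≠ t) :
    AllowedTriple δ K₁ K₂ C₀ C₁ (G.completedDist K₁ C C' M u v)
      (G.completedDist K₁ C C' M v t) (G.completedDist K₁ C C' M u t) := by
  have key := @allowedTriple_of_sorted δ K₁ K₂ C₀ C₁ C C' M V G hG hM
  have s1 := @key u v t huv hvt hut
  have s2 := @key v u t huv.symm hut hvt
  have s3 := @key t v u hvt.symm huv.symm hut.symm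
  have s4 := @key v t u hvt hut.symm huv.symm
  have s5 := @key t u v hut.symm huv hvt.symm
  have s6 := @key u t v hut hvt.symm huv
  rw [completedDist_comm v u] at s2 s3 s4
  rw [completedDist_comm t v] at s3 s5 s6
  rw [completedDist_comm t u] at s3 s4 s5
  generalize G.completedDist K₁ C C' M u v = x at *
  generalize G.completedDist K₁ C C' M v t = y at *
  generalize G.completedDist K₁ C C' M u t = z at *
  rcases le_total x y with h1 | h1 <;> rcases le_total y z with h2 | h2 <;>
    rcases le_total x z with h3 | h3
  · exact (s6 h2 h1).swap₂₃.swap₁₂.swap₂₃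
  · exact (s6 h2 h1).swap₂₃.swap₁₂.swap₂₃
  · exact (s4 h2 h3).swap₂₃.swap₁₂
  · exact (s3 h1 h3).swap₁₂
  · exact (s5 h3 h1).swap₁₂.swap₂₃
  · exact (s2 h3 h2).swap₂₃
  · exact s1 h1 h2
  · exact s1 h1 h2

/-- The completion keeps the labels: the label of an edge is its distance in every realization, so
every distance forced between the ends of the edge lies between the label and `M`. -/
theorem Realizable.completedDist_eq_of_rel (hG : Realizable.{v} G K₁ K₂ C₀ C₁)
    (hM : IsMagic δ K₁ K₂ C₀ C₁ C C' M) {i : ℕ} {u v : V} (h : G.rel i u v) :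
    G.completedDist K₁ C C' M u v = i := by
  have huv : u ≠ v := by
    rintro rfl
    exact G.irrefl i u h
  have hi : G.Forced C C' M i u v := .of_rel h
  have hpos := Nat.one_le_two_pow (n := δ)
  have key : G.completedDist K₁ C C' M u v ≠ M → G.completedDist K₁ C C' M u v = i ∨
      Bounds δ K₁ K₂ C M (G.completedDist K₁ C C' M u v) i := by
    intro hne
    rcases completedDist_cases hM huv hne with ⟨w, hf, hw⟩ | ⟨⟨h3, h4, t, ht1, ht2⟩, -, h6⟩
    · obtain ⟨W, N, p, q, hN, hw₁, hw₂⟩ :=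
        hG.exists_pair hw (.single h) (hf.length_le hM) (by simpa using hpos)
      have := hf.bounds hM hN hw₁
      rw [hw₂.rel_of_single.2] at this
      exact .inr this
    · have hiM := h6 i hi
      subst hiM
      obtain ⟨W, N, p, q, r, hN, hw₁, hw₂, hw₃⟩ := hG.exists_triple (.single ht1) (.single ht2)
        (.single h) (by simpa using hpos) (by simpa using hpos) (by simpa using hpos)
      have hT := hN.allowedTriple hM.acceptable p q r
      rw [hw₁.rel_of_single.2, hw₂.rel_of_single.2, hw₃.rel_of_single.2] at hT
      have := hM.even_of_delta_delta h3 h4 hT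
      have := hM.special_eqs h3 h4
      omega
  rcases Nat.lt_trichotomy i M with hiM | hiM | hiM
  · have hle := completedDist_le (K₁ := K₁) huv hi hiM
    rcases key (by omega) with h | h
    · exact h
    · have := (h.1 (by omega)).1
      omega
  · by_contra hne
    rcases key (by omega) with h | h
    · exact hne h
    · rcases Nat.lt_or_gt_of_ne (hiM ▸ hne) with h' | h'
      · have := (h.1 h').1
        omega
      · have := (h.2 h').1
        omega
  · have hle := hG.le_completedDist hM huv hi hiM
    rcases key (by omega) with h | h
    · exact h
    · have := (h.2 (by omega)).1
      omega

/-- The completion of a realizable graph, as a metric space. -/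
noncomputable def Realizable.completion (hG : Realizable.{v} G K₁ K₂ C₀ C₁)
    (hM : IsMagic δ K₁ K₂ C₀ C₁ C C' M) : ValuedMetric δ V where
  d := G.completedDist K₁ C C' M
  le_delta := completedDist_le_delta hM
  eq_zero_iff u v := by
    constructor
    · intro h
      by_contra huv
      have := one_le_completedDist (G := G) hM huv
      omega
    · rintro rfl
      exact completedDist_self u
  symm := completedDist_comm
  triangle u v t := by
    by_cases huv : u = v
    · subst huv
      exact Nat.le_add_left _ _
    by_cases hvt : v = t
    · subst hvt
      exact Nat.le_add_right _ _
    by_cases hut : u = t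
    · subst hut
      rw [completedDist_self]
      exact Nat.zero_le _
    exact (hG.allowedTriple hM huv hvt hut).2.2.2.2.2.1

theorem Realizable.completion_inClassA (hG : Realizable.{v} G K₁ K₂ C₀ C₁)
    (hM : IsMagic δ K₁ K₂ C₀ C₁ C C' M) : (hG.completion hM).InClassA K₁ K₂ C₀ C₁ := by
  intro u v t huv hvt hut
  obtain ⟨-, -, -, -, -, -, h1, h2⟩ := hG.allowedTriple hM huv hvt hut
  rw [Nat.add_right_comm] at h1 h2
  rw [← Nat.odd_iff] at h1
  rw [← Nat.even_iff] at h2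
  refine ⟨fun h => (h1 h).1, fun h => ?_, fun h => (h1 h).2.2.2.2, h2⟩
  obtain ⟨s1, s2, s3, s4, -⟩ := h1 h
  change G.completedDist K₁ C C' M u v + G.completedDist K₁ C C' M u t +
    G.completedDist K₁ C C' M v t < 2 * K₂ + 2 * min (G.completedDist K₁ C C' M u v)
      (min (G.completedDist K₁ C C' M u t) (G.completedDist K₁ C C' M v t))
  clear h1 h2 h
  omega

end EdgeLabelledGraph

/-- Realizability suffices for a completion, on the same vertex set. -/
theorem EdgeLabelledGraph.Realizable.hasCompletionInA {δ K₁ K₂ C₀ C₁ C C' M : ℕ} {V : Type u}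
    [Finite V] {G : EdgeLabelledGraph δ V} (hG : Realizable.{v} G K₁ K₂ C₀ C₁)
    (hM : IsMagic δ K₁ K₂ C₀ C₁ C C' M) : G.HasCompletionInA K₁ K₂ C₀ C₁ := by
  have hrel : ∀ i u v, G.rel i u v → (hG.completion hM).toEdgeLabelledGraph.rel i u v := by
    intro i u v h
    refine ⟨?_, hG.completedDist_eq_of_rel hM h⟩
    rintro rfl
    exact G.irrefl i u h
  refine ⟨V, inferInstance, hG.completion hM, hG.completion_inClassA hM, fun u v h => ⟨_, h, rfl⟩,
    id, Function.injective_id, hrel, fun s hs => ⟨Subtype.val_injective, fun i u v =>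
      ⟨hrel i u v, fun h => ?_⟩⟩⟩
  obtain ⟨j, hj⟩ := hs u v (fun huv => h.1 (congrArg Subtype.val huv))
  have := (hG.completion hM).toEdgeLabelledGraph.label_unique h (hrel j u v hj)
  exact this ▸ hj

/-! ### Cycles and closed walks -/

namespace EdgeLabelledGraph

variable {δ K₁ K₂ C₀ C₁ C C' M : ℕ}

instance finite_edgeLabelledGraph (n : ℕ) : Finite (EdgeLabelledGraph δ (Fin n)) := by
  refine Finite.of_injective
    (fun G => fun (i : Fin (δ + 1)) (u v : Fin n) => G.rel i u v) fun G H h => ?_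
  have key : ∀ i u v, G.rel i u v ↔ H.rel i u v := by
    intro i u v
    by_cases hi : i < δ + 1
    · exact iff_of_eq (congrFun (congrFun (congrFun h ⟨i, hi⟩) u) v)
    · exact ⟨fun h => absurd (G.label_mem h).2 (by omega),
        fun h => absurd (H.label_mem h).2 (by omega)⟩
  cases G
  cases H
  congr 1
  funext i u v
  exact propext (key i u v)

/-- The cycle on `n + 3` vertices, with the label `ℓ k` on the edge from `k` to `k + 1`. -/
def labelledCycle {n : ℕ} (ℓ : Fin (n + 3) → ℕ) (hℓ : ∀ k, 1 ≤ ℓ k ∧ ℓ k ≤ δ) :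
    EdgeLabelledGraph δ (Fin (n + 3)) where
  rel i u v := (v = u + 1 ∧ i = ℓ u) ∨ (u = v + 1 ∧ i = ℓ v)
  label_mem := by
    rintro i u v (⟨-, rfl⟩ | ⟨-, rfl⟩)
    exacts [hℓ u, hℓ v]
  symm := Or.symm
  irrefl i u h := by
    have : (1 : Fin (n + 3)) = 0 := by
      rcases h with ⟨h, -⟩ | ⟨h, -⟩ <;> exact left_eq_add.1 h
    exact absurd (congrArg Fin.val this) (by simp)
  label_unique := by
    have h2 : ∀ u : Fin (n + 3), u ≠ u + 1 + 1 := by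
      intro u h
      rw [add_assoc] at h
      have := congrArg Fin.val (left_eq_add.1 h)
      rw [Fin.val_add] at this
      replace this : 2 % (n + 3) = 0 := by simpa using this
      rw [Nat.mod_eq_of_lt (by omega)] at this
      omega
    rintro i j u v (⟨h, rfl⟩ | ⟨h, rfl⟩) (⟨h', rfl⟩ | ⟨h', rfl⟩)
    · rfl
    · exact absurd (h ▸ h') (h2 u)
    · exact absurd (h ▸ h') (h2 v)
    · rfl

theorem labelledCycle_isCycle {n : ℕ} (ℓ : Fin (n + 3) → ℕ) (hℓ : ∀ k, 1 ≤ ℓ k ∧ ℓ k ≤ δ) :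
    (labelledCycle ℓ hℓ).IsCycle := by
  refine ⟨n + 3, by omega, ⟨⟨Equiv.refl _, fun {u v} => ?_⟩⟩⟩
  change (SimpleGraph.cycleGraph (n + 1 + 2)).Adj u v ↔
    ∃ i, (v = u + 1 ∧ i = ℓ u) ∨ (u = v + 1 ∧ i = ℓ v)
  rw [SimpleGraph.cycleGraph_adj, sub_eq_iff_eq_add', sub_eq_iff_eq_add']
  constructor
  · rintro (h | h)
    · exact ⟨_, .inr ⟨h, rfl⟩⟩
    · exact ⟨_, .inl ⟨h, rfl⟩⟩
  · rintro ⟨i, ⟨h, -⟩ | ⟨h, -⟩⟩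
    · exact .inr h
    · exact .inl h

/-- A closed walk of length at least three is the image of a cycle with the same labels. -/
theorem LabelWalk.exists_cycle {V : Type*} {G : EdgeLabelledGraph δ V} {w : List ℕ} {u : V}
    (h : G.LabelWalk w u u) {n : ℕ} (hn : w.length = n + 3) :
    ∃ O : EdgeLabelledGraph δ (Fin (n + 3)), O.IsCycle ∧ (∃ f : Fin (n + 3) → V, IsHom O G f) ∧
      O.LabelWalk w 0 0 := by
  obtain ⟨p, h0, h1, hp⟩ := h.exists_vertices
  have hℓ : ∀ k : Fin (n + 3), 1 ≤ w.getD k 0 ∧ w.getD k 0 ≤ δ := fun k =>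
    G.label_mem (hp k (by omega))
  refine ⟨labelledCycle (fun k => w.getD k 0) hℓ, labelledCycle_isCycle _ _,
    ⟨fun k => p k, ?_⟩, ?_⟩
  · have key : ∀ k : Fin (n + 3), G.rel (w.getD k 0) (p k) (p (k + 1 : Fin (n + 3))) := by
      intro k
      have hk := hp k (by omega)
      by_cases hlast : k = Fin.last (n + 2)
      · subst hlast
        have : p ((Fin.last (n + 2) : ℕ) + 1) = p 0 := by
          rw [h0, ← h1, hn, Fin.val_last]
        rw [this] at hk
        rw [Fin.last_add_one]
        exact hk
      · rwa [Fin.val_add_one_of_lt (Fin.lt_last_iff_ne_last.2 hlast)]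
    rintro i a b (⟨rfl, rfl⟩ | ⟨rfl, rfl⟩)
    · exact key a
    · exact G.symm (key b)
  · have := LabelWalk.of_vertices (G := labelledCycle (fun k => w.getD k 0) hℓ) (w := w)
      (fun k => Fin.ofNat (n + 3) k) fun k hk => by
        refine .inl ⟨Fin.ext (Nat.add_mod k 1 (n + 3)), ?_⟩
        change _ = w.getD (k % (n + 3)) 0
        rw [Nat.mod_eq_of_lt (by omega)]
    rw [hn] at this
    simpa using this

/-- The space with two points at distance `i`. -/
def _root_.ValuedMetric.twoPoint {i : ℕ} (hi : 1 ≤ i) (hi' : i ≤ δ) :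
    ValuedMetric δ (ULift.{v} Bool) where
  d p q := if p = q then 0 else i
  le_delta p q := by split_ifs <;> omega
  eq_zero_iff p q := by
    split_ifs with h
    · simp [h]
    · simp only [h, iff_false]
      omega
  symm p q := by simp only [eq_comm]
  triangle p q r := by
    by_cases hpq : p = q
    · subst hpq
      simp
    · rw [if_neg hpq]
      split_ifs <;> omega

theorem _root_.ValuedMetric.twoPoint_inClassA {i : ℕ} (hi : 1 ≤ i) (hi' : i ≤ δ) :
    (ValuedMetric.twoPoint.{v} hi hi').InClassA K₁ K₂ C₀ C₁ := by
  rintro ⟨p⟩ ⟨q⟩ ⟨r⟩ hpq hqr hpr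
  cases p <;> cases q <;> cases r <;> simp at hpq hqr hpr

/-- Closed walks of length less than three are realized by two points. -/
theorem LabelWalk.exists_realization_of_length_lt {V : Type*} {G : EdgeLabelledGraph δ V}
    (hδ : 1 ≤ δ) {w : List ℕ} {u : V} (h : G.LabelWalk w u u) (hw : w.length < 3) :
    ∃ (W : Type v) (N : ValuedMetric δ W) (p : W), N.InClassA K₁ K₂ C₀ C₁ ∧
      N.toEdgeLabelledGraph.LabelWalk w p p := by
  match w, h with
  | [], _ => exact ⟨_, _, ⟨true⟩, ValuedMetric.twoPoint_inClassA le_rfl hδ, .nil _⟩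
  | [i], h => exact absurd h.rel_of_single (G.irrefl i u)
  | [i, j], h =>
    obtain ⟨v, hi, hj⟩ := LabelWalk.exists_of_append (w₁ := [i]) (w₂ := [j]) h
    have hi := hi.rel_of_single
    obtain rfl := G.label_unique hi (G.symm hj.rel_of_single)
    obtain ⟨l1, l2⟩ := G.label_mem hi
    exact ⟨_, _, ⟨true⟩, ValuedMetric.twoPoint_inClassA l1 l2,
      .cons (v := ⟨false⟩) ⟨by simp, by simp [ValuedMetric.twoPoint]⟩
        (.single ⟨by simp, by simp [ValuedMetric.twoPoint]⟩)⟩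
  | _ :: _ :: _ :: _, _ =>
    simp only [List.length_cons] at hw
    omega

/-- A graph that maps homomorphically to a member of the class is realizable. -/
theorem Realizable.of_isHom {V : Type*} {W : Type v} {G : EdgeLabelledGraph δ V}
    {N : ValuedMetric δ W} (hN : N.InClassA K₁ K₂ C₀ C₁) {f : V → W}
    (hf : IsHom G N.toEdgeLabelledGraph f) : Realizable.{v} G K₁ K₂ C₀ C₁ :=
  fun _ u hw _ => ⟨W, N, f u, hN, hw.map hf⟩

/-- A graph is realizable if every short cycle that maps to it has a completion. -/
theorem Realizable.of_cycles {V : Type*} {G : EdgeLabelledGraph δ V} (hδ : 1 ≤ δ)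
    (h : ∀ n, n ≤ 2 ^ δ * 3 → ∀ O : EdgeLabelledGraph δ (Fin n), O.IsCycle →
      (∃ f : Fin n → V, IsHom O G f) → O.HasCompletionInA K₁ K₂ C₀ C₁) :
    Realizable.{0} G K₁ K₂ C₀ C₁ := by
  intro w u hw hl
  rcases Nat.lt_or_ge w.length 3 with h3 | h3
  · exact hw.exists_realization_of_length_lt hδ h3
  · obtain ⟨n, hn⟩ := Nat.exists_eq_add_of_le' h3
    obtain ⟨O, hO, hf, hw⟩ := hw.exists_cycle hn
    obtain ⟨W, -, N, hN, -, g, -, hg⟩ := h (n + 3) (hn ▸ hl) O hO hf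
    exact ⟨W, N, g 0, hN, hw.map hg.1⟩

end EdgeLabelledGraph

theorem lemma6p3 (δ K₁ K₂ C₀ C₁ : ℕ) (hadm : PrimitiveAdmissible δ K₁ K₂ C₀ C₁) :
    ∃ 𝒪 : Set (Σ n : ℕ, EdgeLabelledGraph δ (Fin n)),
      𝒪.Finite ∧
      (∀ O ∈ 𝒪, O.2.IsCycle ∧ O.1 ≤ 2 ^ δ * 3) ∧
      ∀ (V : Type u) [Finite V] (G : EdgeLabelledGraph δ V),
        G.HasCompletionInA K₁ K₂ C₀ C₁ ↔
          ∀ O ∈ 𝒪, ¬ ∃ f : Fin O.1 → V, EdgeLabelledGraph.IsHom O.2 G f := by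
  obtain ⟨C, C', M, hM⟩ := hadm.exists_isMagic
  have hδ : 1 ≤ δ := by
    have := hM.acceptable.three_le
    omega
  refine ⟨{O | (O.2.IsCycle ∧ O.1 ≤ 2 ^ δ * 3) ∧ ¬ O.2.HasCompletionInA K₁ K₂ C₀ C₁}, ?_,
    fun O hO => hO.1, fun V _ G => ⟨?_, fun h => ?_⟩⟩
  · refine ((Set.finite_Iic (2 ^ δ * 3)).biUnion fun n _ =>
      Set.finite_range (Sigma.mk (β := fun n => EdgeLabelledGraph δ (Fin n)) n)).subset ?_
    rintro ⟨n, O⟩ hO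
    exact Set.mem_biUnion (Set.mem_Iic.2 hO.1.2) ⟨O, rfl⟩
  · rintro ⟨W, -, N, hN, -, g, -, hg⟩ O hO ⟨f, hf⟩
    exact hO.2 ((EdgeLabelledGraph.Realizable.of_isHom hN
      (fun i u v h => hg.1 i _ _ (hf i u v h) : EdgeLabelledGraph.IsHom O.2 _
        (g ∘ f))).hasCompletionInA hM)
  · refine (EdgeLabelledGraph.Realizable.of_cycles hδ fun n hn O hO hf => ?_).hasCompletionInA hM
    by_contra hno
    exact h ⟨n, O⟩ ⟨⟨hO, hn⟩, hno⟩ hf
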